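/- Let $C_\omega>0$, and let $X$ be the real Hilbert space of real functions $\psi\in H^1(\mathbb R)$ with $\|\psi\|_X^2:=\int_{\mathbb R}(|\psi'(s)|^2+s^2|\psi(s)|^2)\,ds<\infty$. For $\lambda\ge 0$ and $\psi\in X$ put $$E_\lambda(\psi)=\int_{\mathbb R}|\psi'|^2\,ds+\int_{\mathbb R}s^2|\psi|^2\,ds+C_\omega\int_{\mathbb R}\sqrt{1+2\lambda|\psi|^2}\,|\psi|^2\,ds,\qquad Q(\psi)=\int_{\mathbb R}|\psi|^2\,ds .$$ For every $\lambda\ge0$ there is exactly one nonnegative $\varphi_\lambda\in X$ with $Q(\varphi_\lambda)=1$ that minimizes $E_\lambda$ on $\{\psi\in X: Q(\psi)=1\}$, and exactly one $\mu_{\min}(\lambda)\in\mathbb R$ such that, weakly (tested against all $\eta\in X$), $$-\varphi_\lambda''+s^2\varphi_\lambda+C_\omega\frac{1+3\lambda\varphi_\lambda^2}{\sqrt{1+2\lambda\varphi_\lambda^2}}\,\varphi_\lambda=\mu_{\min}(\lambda)\,\varphi_\lambda .$$ Put $E_{\min}(\lambda):=E_\lambda(\varphi_\lambda)$ for $\lambda\ge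 0$. Then: 1. $E_{\min}$ is positive, strictly increasing and concave on $[0,\infty)$, and $\lim_{\lambda\to+\infty}E_{\min}(\lambda)=+\infty$. 2. If the curve $\lambda\mapsto\varphi_\lambda\in X$ is continuously differentiable on $(0,\infty)$, then $E_{\min}\in C^1(0,\infty)$ and, for all $\lambda>0$, $$\frac{d}{d\lambda}E_{\min}(\lambda)=C_\omega\int_{\mathbb R}\frac{\varphi_\lambda(s)^4}{\sqrt{1+2\lambda\varphi_\lambda(s)^2}}\,ds ,$$ where the integral converges. 3. $\mu_{\min}$ is continuous on $[0,\infty)$, $\lim_{\lambda\to+\infty}\mu_{\min}(\lambda)=+\infty$, and for all $\lambda>0$ $$E_{\min}(\lambda)=\frac1\lambda\int_0^\lambda\mu_{\min}(\xi)\,d\xi .$$ -/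

import Mathlib

open MeasureTheory Set Filter Topology
open scoped ContDiff

noncomputable section

namespace CigarBEC

/-- The real Hilbert space `L²(ℝ)` (Lebesgue measure). -/
abbrev L2R : Type := Lp ℝ 2 (volume : Measure ℝ)

/-- `g` is the weak derivative of `f` on `ℝ`: `∫ f η' = - ∫ g η` for all test functions `η`. -/
def IsWeakDeriv (f g : L2R) : Prop :=
  ∀ η : ℝ → ℝ, ContDiff ℝ ∞ η → HasCompactSupport η →
    ∫ s, f s * deriv η s = -∫ s, g s * η s

theorem integrable_mul_test (f : L2R) {η : ℝ → ℝ} (hη : Continuous η)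
    (hc : HasCompactSupport η) : Integrable (fun s => f s * η s) :=
  (Lp.memLp f).integrable_mul
    (hη.memLp_of_hasCompactSupport hc : MemLp η 2 (volume : Measure ℝ))

theorem integrable_mul_deriv_test (f : L2R) {η : ℝ → ℝ} (hη : ContDiff ℝ ∞ η)
    (hc : HasCompactSupport η) : Integrable (fun s => f s * deriv η s) :=
  integrable_mul_test f (hη.continuous_deriv (by simp)) hc.deriv

theorem IsWeakDeriv.add {f₁ g₁ f₂ g₂ : L2R} (h₁ : IsWeakDeriv f₁ g₁) (h₂ : IsWeakDeriv f₂ g₂) :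
    IsWeakDeriv (f₁ + f₂) (g₁ + g₂) := by
  intro η hη hc
  have e₁ : (fun s => (f₁ + f₂ : L2R) s * deriv η s) =ᵐ[volume]
      fun s => f₁ s * deriv η s + f₂ s * deriv η s := by
    filter_upwards [Lp.coeFn_add f₁ f₂] with s hs
    rw [hs, Pi.add_apply, add_mul]
  have e₂ : (fun s => (g₁ + g₂ : L2R) s * η s) =ᵐ[volume] fun s => g₁ s * η s + g₂ s * η s := by
    filter_upwards [Lp.coeFn_add g₁ g₂] with s hs
    rw [hs, Pi.add_apply, add_mul]
  rw [integral_congr_ae e₁, integral_congr_ae e₂,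
    integral_add (integrable_mul_deriv_test f₁ hη hc) (integrable_mul_deriv_test f₂ hη hc),
    integral_add (integrable_mul_test g₁ hη.continuous hc) (integrable_mul_test g₂ hη.continuous hc),
    h₁ η hη hc, h₂ η hη hc]
  ring

theorem IsWeakDeriv.smul {f g : L2R} (c : ℝ) (h : IsWeakDeriv f g) :
    IsWeakDeriv (c • f) (c • g) := by
  intro η hη hc
  have e₁ : (fun s => (c • f : L2R) s * deriv η s) =ᵐ[volume] fun s => c * (f s * deriv η s) := by
    filter_upwards [Lp.coeFn_smul c f] with s hs
    rw [hs, Pi.smul_apply, smul_eq_mul, mul_assoc]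
  have e₂ : (fun s => (c • g : L2R) s * η s) =ᵐ[volume] fun s => c * (g s * η s) := by
    filter_upwards [Lp.coeFn_smul c g] with s hs
    rw [hs, Pi.smul_apply, smul_eq_mul, mul_assoc]
  rw [integral_congr_ae e₁, integral_congr_ae e₂, integral_const_mul, integral_const_mul,
    h η hη hc]
  ring

theorem isWeakDeriv_zero : IsWeakDeriv 0 0 := by
  intro η hη hc
  have e (ζ : ℝ → ℝ) : (fun s => (0 : L2R) s * ζ s) =ᵐ[volume] fun _ => (0 : ℝ) := by
    filter_upwards [Lp.coeFn_zero ℝ 2 (volume : Measure ℝ)] with s hs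
    rw [hs, Pi.zero_apply, zero_mul]
  rw [integral_congr_ae (e _), integral_congr_ae (e _)]
  simp

theorem IsWeakDeriv.unique {f g₁ g₂ : L2R} (h₁ : IsWeakDeriv f g₁) (h₂ : IsWeakDeriv f g₂) :
    g₁ = g₂ := by
  have hl (g : L2R) : LocallyIntegrable g (volume : Measure ℝ) :=
    (Lp.memLp g).locallyIntegrable (by norm_num)
  apply Lp.ext
  refine ae_eq_of_integral_contDiff_smul_eq (hl g₁) (hl g₂) ?_
  intro η hη hc
  have := (h₁ η hη hc).symm.trans (h₂ η hη hc)
  simpa [mul_comm] using this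

/-- The space of those `ψ ∈ H¹(ℝ)` with `∫ (|ψ'|² + s²|ψ|²) ds < ∞`, as a linear subspace of
`L²(ℝ)`: `ψ ∈ L²` has a weak derivative in `L²` and `s ↦ s ψ(s)` is in `L²`. -/
def energySubmodule : Submodule ℝ L2R where
  carrier := {ψ | (∃ g : L2R, IsWeakDeriv ψ g) ∧ MemLp (fun s : ℝ => s * ψ s) 2 volume}
  zero_mem' := by
    refine ⟨⟨0, isWeakDeriv_zero⟩, ?_⟩
    refine (MemLp.zero' (ε := ℝ) (p := 2) (μ := volume)).ae_eq ?_
    filter_upwards [Lp.coeFn_zero ℝ 2 (volume : Measure ℝ)] with s hs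
    rw [hs, Pi.zero_apply, mul_zero]
  add_mem' := by
    rintro a b ⟨⟨ga, ha⟩, ha'⟩ ⟨⟨gb, hb⟩, hb'⟩
    refine ⟨⟨ga + gb, ha.add hb⟩, (ha'.add hb').ae_eq ?_⟩
    filter_upwards [Lp.coeFn_add a b] with s hs
    rw [hs, Pi.add_apply, Pi.add_apply, mul_add]
  smul_mem' := by
    rintro c a ⟨⟨ga, ha⟩, ha'⟩
    refine ⟨⟨c • ga, ha.smul c⟩, (ha'.const_smul c).ae_eq ?_⟩
    filter_upwards [Lp.coeFn_smul c a] with s hs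
    rw [hs, Pi.smul_apply, Pi.smul_apply, smul_eq_mul, smul_eq_mul]
    ring

/-- The energy space `X`, a type of its own: it does not inherit the norm of `L²(ℝ)`. -/
def X : Type := energySubmodule

instance instAddCommGroupX : AddCommGroup X := inferInstanceAs (AddCommGroup energySubmodule)

instance instModuleX : Module ℝ X := inferInstanceAs (Module ℝ energySubmodule)

/-- The inclusion of `X` into `L²(ℝ)`. -/
def toL2 : X →ₗ[ℝ] L2R := energySubmodule.subtype

theorem toL2_injective : Function.Injective toL2 := Subtype.val_injective

instance instCoeFunX : CoeFun X fun _ => ℝ → ℝ := ⟨fun ψ => (toL2 ψ : ℝ → ℝ)⟩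

theorem exists_weakDeriv (ψ : X) : ∃ g : L2R, IsWeakDeriv (toL2 ψ) g := ψ.2.1

theorem memLp_mul (ψ : X) : MemLp (fun s : ℝ => s * ψ s) 2 volume := ψ.2.2

/-- The weak derivative `ψ ↦ ψ'`. -/
def wderiv : X →ₗ[ℝ] L2R where
  toFun ψ := (exists_weakDeriv ψ).choose
  map_add' φ ψ := (exists_weakDeriv (φ + ψ)).choose_spec.unique (by
    rw [map_add]
    exact (exists_weakDeriv φ).choose_spec.add (exists_weakDeriv ψ).choose_spec)
  map_smul' c ψ := (exists_weakDeriv (c • ψ)).choose_spec.unique (by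
    rw [map_smul]
    exact (exists_weakDeriv ψ).choose_spec.smul c)

theorem isWeakDeriv_wderiv (ψ : X) : IsWeakDeriv (toL2 ψ) (wderiv ψ) :=
  (exists_weakDeriv ψ).choose_spec

/-- Multiplication by the variable, `ψ ↦ (s ↦ s ψ(s))`. -/
def mulVar : X →ₗ[ℝ] L2R where
  toFun ψ := (memLp_mul ψ).toLp
  map_add' φ ψ := by
    rw [← MemLp.toLp_add]
    refine MemLp.toLp_congr _ _ ?_
    filter_upwards [Lp.coeFn_add (toL2 φ) (toL2 ψ)] with s hs
    rw [map_add, hs, Pi.add_apply, Pi.add_apply, mul_add]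
  map_smul' c ψ := by
    rw [RingHom.id_apply, ← MemLp.toLp_const_smul]
    refine MemLp.toLp_congr _ _ ?_
    filter_upwards [Lp.coeFn_smul c (toL2 ψ)] with s hs
    rw [map_smul, hs, Pi.smul_apply, Pi.smul_apply, smul_eq_mul, smul_eq_mul]
    ring

theorem coeFn_mulVar (ψ : X) : (mulVar ψ : ℝ → ℝ) =ᵐ[volume] fun s => s * ψ s :=
  (memLp_mul ψ).coeFn_toLp

theorem eq_zero_of_mulVar_eq_zero {ψ : X} (h : mulVar ψ = 0) : ψ = 0 := by
  apply toL2_injective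
  rw [map_zero]
  apply Lp.ext
  have h0 : (mulVar ψ : ℝ → ℝ) =ᵐ[volume] 0 := by
    rw [h]
    exact Lp.coeFn_zero ℝ 2 (volume : Measure ℝ)
  have hne : ∀ᵐ s : ℝ, s ≠ 0 := by simp [ae_iff]
  filter_upwards [h0, coeFn_mulVar ψ, Lp.coeFn_zero ℝ 2 (volume : Measure ℝ), hne]
    with s h1 h2 h3 h4
  rw [h3]
  have : s * ψ s = 0 := by rw [← h2, h1, Pi.zero_apply]
  simpa [h4] using this

/-- The inner product `(φ|ψ) = ∫ (φ' ψ' + s² φ ψ) ds` of `X`. -/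
@[reducible] def innerCore : InnerProductSpace.Core ℝ X where
  inner φ ψ := inner ℝ (wderiv φ) (wderiv ψ) + inner ℝ (mulVar φ) (mulVar ψ)
  conj_inner_symm φ ψ := by
    simp [real_inner_comm]
  re_inner_nonneg φ := add_nonneg real_inner_self_nonneg real_inner_self_nonneg
  add_left φ ψ χ := by
    simp only [map_add, inner_add_left]
    ring
  smul_left φ ψ c := by
    simp only [map_smul, real_inner_smul_left, conj_trivial]
    ring
  definite φ h := by
    have h1 : (0 : ℝ) ≤ inner ℝ (wderiv φ) (wderiv φ) := real_inner_self_nonneg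
    have h2 : (0 : ℝ) ≤ inner ℝ (mulVar φ) (mulVar φ) := real_inner_self_nonneg
    have h' : inner ℝ (wderiv φ) (wderiv φ) + inner ℝ (mulVar φ) (mulVar φ) = (0 : ℝ) := h
    have h3 : inner ℝ (mulVar φ) (mulVar φ) = (0 : ℝ) := by linarith
    exact eq_zero_of_mulVar_eq_zero (inner_self_eq_zero.mp h3)

instance instNormedAddCommGroupX : NormedAddCommGroup X :=
  @InnerProductSpace.Core.toNormedAddCommGroup ℝ X _ _ _ innerCore

instance instInnerProductSpaceX : InnerProductSpace ℝ X :=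
  InnerProductSpace.ofCore innerCore.toCore

theorem inner_def (φ ψ : X) :
    inner ℝ φ ψ = ∫ s, (wderiv φ s * wderiv ψ s + s ^ 2 * (φ s * ψ s)) := by
  have h : inner ℝ φ ψ = inner ℝ (wderiv φ) (wderiv ψ) + inner ℝ (mulVar φ) (mulVar ψ) := rfl
  rw [h, L2.inner_def, L2.inner_def, ← integral_add (L2.integrable_inner _ _)
    (L2.integrable_inner _ _)]
  refine integral_congr_ae ?_
  filter_upwards [coeFn_mulVar φ, coeFn_mulVar ψ] with s h1 h2
  simp only [h1, h2, RCLike.inner_apply, conj_trivial]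
  ring

/-- The energy
`E_λ(ψ) = ∫ |ψ'|² ds + ∫ s² |ψ|² ds + C ∫ √(1 + 2 λ |ψ|²) |ψ|² ds`. -/
def energy (C lam : ℝ) (ψ : X) : ℝ :=
  (∫ s, (wderiv ψ s) ^ 2) + (∫ s, s ^ 2 * (ψ s) ^ 2) +
    C * ∫ s, Real.sqrt (1 + 2 * lam * (ψ s) ^ 2) * (ψ s) ^ 2

/-- The charge `Q(ψ) = ∫ |ψ|² ds`. -/
def charge (ψ : X) : ℝ := ∫ s, (ψ s) ^ 2

/-- `φ` is a nonnegative ground state: it has charge one and minimizes the energy among all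
elements of `X` of charge one. -/
def IsGroundState (C lam : ℝ) (φ : X) : Prop :=
  charge φ = 1 ∧ (∀ ψ : X, charge ψ = 1 → energy C lam φ ≤ energy C lam ψ) ∧
    ∀ᵐ s : ℝ, 0 ≤ φ s

/-- The nonlinearity `f_λ(ρ) = (1 + 3 λ ρ²) / √(1 + 2 λ ρ²)`. -/
def nonlin (lam ρ : ℝ) : ℝ := (1 + 3 * lam * ρ ^ 2) / Real.sqrt (1 + 2 * lam * ρ ^ 2)

/-- `φ ∈ X` solves `-φ'' + s² φ + C f_λ(|φ|) φ = μ φ` weakly, that is, as an identity in the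
dual space of `X`. -/
def IsChemicalPotential (C lam : ℝ) (φ : X) (μ : ℝ) : Prop :=
  ∀ η : X, (∫ s, wderiv φ s * wderiv η s) + (∫ s, s ^ 2 * (φ s * η s)) +
    C * (∫ s, nonlin lam |φ s| * φ s * η s) = μ * ∫ s, φ s * η s

/-- The ground state `φ_λ`. -/
def groundState (C lam : ℝ) : X := Classical.epsilon (IsGroundState C lam)

/-- The minimal energy `E_min(λ) = E_λ(φ_λ)`. -/
def Emin (C lam : ℝ) : ℝ := energy C lam (groundState C lam)

/-- The chemical potential `μ_min(λ) = μ(φ_λ)`: the number `μ` for which `φ_λ` solves the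
equation. -/
def muMin (C lam : ℝ) : ℝ :=
  Classical.epsilon (IsChemicalPotential C lam (groundState C lam))

end CigarBEC

end

noncomputable section

namespace CigarBEC

/-! The energy is convex in the density `ψ²`. Replacing `φ`, `ψ` by `√((φ² + ψ²)/2)` averages the
charge and does not raise the quadratic part above its average, while for `λ > 0` the interaction `ρ
↦ √(1 + 2λρ) ρ` is strongly convex on bounded densities (`exists_energy_le_mean`). Hence, for two
states of charge one, `∫ (φ² - ψ²)²` is controlled by their excess energy
(`integral_quadraticDiff_le`).

This one estimate has three uses. It gives uniqueness of the nonnegative minimizer. It makes fast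
minimizing sequences Cauchy in `L²`, since `(φ - ψ)⁴ ≤ (φ² - ψ²)²` for nonnegative functions and the
weight `s²` controls the tails; semicontinuity then gives existence. It also makes the density of
`φ_λ` continuous in `λ > 0`. At `λ = 0` the strong convexity is lost, and the minimizer is found
from `‖ψ‖² - Q(ψ) = ∫ (ψ' + sψ)²`.

For fixed `ψ` the energy is concave in `λ`, with derivative `C ∫ ψ⁴/√(1 + 2λψ²)`. Evaluated at
`φ_λ`, this number `D(λ)` is a positive supergradient of `E_min` (`Emin_le_tangent`), whence
monotonicity, concavity and `D` nonincreasing. Continuity of `D` on `(0,∞)` then gives `E_min' = D`.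
Testing the Euler–Lagrange equation with `φ_λ` yields `μ_min = E_min + λ D = (λ E_min)'`, which is
the integral formula. -/

/-! ### Absolutely continuous representatives of weakly differentiable functions. -/

/-- A function on `ℝ` that is absolutely continuous on every compact interval. -/
def LocallyAC (F : ℝ → ℝ) : Prop := ∀ a b, AbsolutelyContinuousOnInterval F a b

theorem LocallyAC.continuous {F : ℝ → ℝ} (hF : LocallyAC F) : Continuous F := by
  rw [continuous_iff_continuousAt]
  intro x
  refine ((hF (x - 1) (x + 1)).continuousOn).continuousAt ?_
  rw [uIcc_of_le (by linarith)]
  exact Icc_mem_nhds (by linarith) (by linarith)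

theorem LocallyAC.mul {F G : ℝ → ℝ} (hF : LocallyAC F) (hG : LocallyAC G) :
    LocallyAC (fun x => F x * G x) := fun a b => (hF a b).fun_mul (hG a b)

theorem locallyAC_of_contDiff {F : ℝ → ℝ} (hF : ContDiff ℝ 1 F) : LocallyAC F :=
  fun _ _ => hF.contDiffOn.absolutelyContinuousOnInterval

theorem LocallyAC.ae_differentiableAt {F : ℝ → ℝ} (hF : LocallyAC F) :
    ∀ᵐ x : ℝ, DifferentiableAt ℝ F x := by
  have h : ∀ᵐ x : ℝ, ∀ n : ℕ, x ∈ uIcc (-(n : ℝ)) n → DifferentiableAt ℝ F x :=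
    ae_all_iff.2 fun n => (hF _ _).ae_differentiableAt
  filter_upwards [h] with x hx
  obtain ⟨n, hn⟩ := exists_nat_ge |x|
  refine hx n ?_
  rw [uIcc_of_le (by have := abs_nonneg x; linarith)]
  exact abs_le.1 hn

theorem LocallyAC.of_dist_le {F G : ℝ → ℝ} (hG : LocallyAC G)
    (h : ∀ a b, |F a - F b| ≤ |G a - G b|) : LocallyAC F := by
  intro a b
  refine squeeze_zero (fun E => Finset.sum_nonneg fun _ _ => dist_nonneg)
    (fun E => Finset.sum_le_sum fun i _ => ?_) (hG a b)
  simpa [Real.dist_eq] using h (E.2 i).1 (E.2 i).2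

theorem locallyAC_integral {g : ℝ → ℝ} (hg : LocallyIntegrable g (volume : Measure ℝ)) :
    LocallyAC (fun x => ∫ t in (0 : ℝ)..x, g t) := by
  have hi (x y : ℝ) : IntervalIntegrable g volume x y :=
    intervalIntegrable_iff.mpr <|
      (hg.integrableOn_isCompact isCompact_uIcc).mono_set uIoc_subset_uIcc
  intro a b
  -- The interval is enlarged to contain the base point `0` together with `a` and `b`.
  have h := (hi (min a 0 ⊓ b) (max a 0 ⊔ b)).absolutelyContinuousOnInterval_intervalIntegral
    (c := 0) (by
      rw [uIcc_of_le (by simp)]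
      simp)
  refine h.mono ?_
  rw [uIcc_of_le (a := min a 0 ⊓ b) (by simp)]
  refine Icc_subset_Icc (by simp) ?_
  rcases le_total a b with hab | hab <;> simp [hab]

/-- The primitive started at `-∞` vanishes to the left of the support, and to its right because the
total integral is zero. -/
theorem exists_test_primitive {θ : ℝ → ℝ} (hθ : ContDiff ℝ ∞ θ) (hc : HasCompactSupport θ)
    (h0 : ∫ x, θ x = 0) :
    ∃ ζ : ℝ → ℝ, ContDiff ℝ ∞ ζ ∧ HasCompactSupport ζ ∧ deriv ζ = θ := by
  obtain ⟨R, hR⟩ := hc.isCompact.isBounded.subset_closedBall 0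
  have hz : ∀ x, R < |x| → θ x = 0 := by
    intro x hx
    by_contra hne
    have := hR (subset_tsupport θ hne)
    rw [mem_closedBall_zero_iff, Real.norm_eq_abs] at this
    linarith
  have hint : Integrable θ := hθ.continuous.integrable_of_hasCompactSupport hc
  have hd : ∀ x, HasDerivAt (fun y => ∫ t in Iic y, θ t) (θ x) x := by
    intro x
    have h1 : (fun y => ∫ t in Iic y, θ t) =
        fun y => (∫ t in Iic (0 : ℝ), θ t) + ∫ t in (0 : ℝ)..y, θ t := by
      ext y
      rw [← intervalIntegral.integral_Iic_sub_Iic hint.integrableOn hint.integrableOn]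
      ring
    rw [h1]
    exact (intervalIntegral.integral_hasDerivAt_right (hint.intervalIntegrable)
      (hθ.continuous.stronglyMeasurableAtFilter _ _) hθ.continuous.continuousAt).const_add _
  have hder : deriv (fun y => ∫ t in Iic y, θ t) = θ := funext fun x => (hd x).deriv
  refine ⟨fun y => ∫ t in Iic y, θ t, ?_, ?_, hder⟩
  · rw [contDiff_infty_iff_deriv, hder]
    exact ⟨fun x => (hd x).differentiableAt, hθ⟩
  · refine HasCompactSupport.of_support_subset_isCompact (isCompact_Icc (a := -R) (b := R)) ?_
    intro x hx
    rw [Function.mem_support] at hx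
    by_contra hxR
    apply hx
    rw [mem_Icc, not_and_or, not_le, not_le] at hxR
    rcases hxR with h | h
    · refine setIntegral_eq_zero_of_forall_eq_zero fun t ht => hz t ?_
      have := neg_le_abs t
      have : t ≤ x := ht
      linarith
    · have h2 : ∫ t in Ioi x, θ t = 0 :=
        setIntegral_eq_zero_of_forall_eq_zero fun t ht => hz t (by
          have := le_abs_self t
          have : x < t := ht
          linarith)
      have h3 := integral_add_compl (measurableSet_Iic (a := x)) hint
      rw [compl_Iic, h2, h0] at h3
      simpa using h3

/-- The du Bois-Reymond lemma: subtracting from a test function its integral times a normalized bump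
leaves the derivative of a test function. -/
theorem ae_const_of_integral_mul_deriv_eq_zero {u : ℝ → ℝ}
    (hu : LocallyIntegrable u (volume : Measure ℝ))
    (h : ∀ η : ℝ → ℝ, ContDiff ℝ ∞ η → HasCompactSupport η → ∫ s, u s * deriv η s = 0) :
    ∃ c : ℝ, ∀ᵐ s : ℝ, u s = c := by
  let b : ContDiffBump (0 : ℝ) := default
  set χ : ℝ → ℝ := b.normed volume with hχ
  have hχs : ContDiff ℝ ∞ χ := b.contDiff_normed
  have hχc : HasCompactSupport χ := b.hasCompactSupport_normed
  have hχ1 : ∫ x, χ x = 1 := b.integral_normed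
  refine ⟨∫ x, u x * χ x, ?_⟩
  refine ae_eq_of_integral_contDiff_smul_eq hu (locallyIntegrable_const _) ?_
  intro η hη hc
  have hηi : Integrable η := hη.continuous.integrable_of_hasCompactSupport hc
  have hχi : Integrable χ := hχs.continuous.integrable_of_hasCompactSupport hχc
  obtain ⟨ζ, hζ, hζc, hζd⟩ := exists_test_primitive
    (θ := fun x => η x - (∫ y, η y) * χ x) (hη.sub (contDiff_const.mul hχs))
    (hc.sub hχc.mul_left) (by
      rw [integral_sub hηi (hχi.const_mul _), integral_const_mul, hχ1, mul_one, sub_self])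
  have h1 := h ζ hζ hζc
  have hi1 : Integrable (fun s => u s * η s) := by
    simpa [mul_comm] using hu.integrable_smul_left_of_hasCompactSupport hη.continuous hc
  have hi2 : Integrable (fun s => u s * χ s) := by
    simpa [mul_comm] using hu.integrable_smul_left_of_hasCompactSupport hχs.continuous hχc
  rw [hζd] at h1
  have h2 : ∫ s, u s * (η s - (∫ y, η y) * χ s) =
      (∫ s, u s * η s) - (∫ y, η y) * ∫ s, u s * χ s := by
    rw [← integral_const_mul, ← integral_sub hi1 (hi2.const_mul _)]
    congr 1
    ext s
    ring
  rw [h2] at h1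
  simp only [smul_eq_mul]
  rw [integral_mul_const]
  simp_rw [mul_comm (η _)]
  linarith

theorem LocallyAC.integral_mul_deriv {F : ℝ → ℝ} (hF : LocallyAC F) {η : ℝ → ℝ}
    (hη : ContDiff ℝ ∞ η) (hc : HasCompactSupport η) :
    ∫ s, F s * deriv η s = -∫ s, deriv F s * η s := by
  obtain ⟨R, hR⟩ := hc.isCompact.isBounded.subset_closedBall 0
  have hout {ζ : ℝ → ℝ} (hζ : tsupport ζ ⊆ tsupport η) (k : ℝ → ℝ) :
      ∫ s, k s * ζ s = ∫ s in (-(|R| + 1))..(|R| + 1), k s * ζ s := by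
    rw [intervalIntegral.integral_eq_integral_of_support_subset]
    intro x hx
    have hx' : x ∈ tsupport η := hζ (subset_tsupport ζ (right_ne_zero_of_mul hx))
    have := hR hx'
    rw [mem_closedBall_zero_iff, Real.norm_eq_abs] at this
    have h2 := abs_le.1 this
    have h3 := le_abs_self R
    exact ⟨by linarith, by linarith⟩
  have hz : ∀ x, |x| = |R| + 1 → η x = 0 := by
    intro x hx
    by_contra hne
    have := hR (subset_tsupport η hne)
    rw [mem_closedBall_zero_iff, Real.norm_eq_abs, hx] at this
    have h3 := le_abs_self R
    linarith
  rw [hout tsupport_deriv_subset, hout subset_rfl,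
    (hF _ _).integral_mul_deriv_eq_deriv_mul
      (locallyAC_of_contDiff (hη.of_le (by simp)) _ _), hz (|R| + 1) (abs_of_nonneg (by positivity)),
    hz (-(|R| + 1)) (by rw [abs_neg]; exact abs_of_nonneg (by positivity))]
  simp

theorem isWeakDeriv_of_locallyAC {f g : L2R} {F : ℝ → ℝ} (hF : LocallyAC F)
    (hf : ∀ᵐ s : ℝ, f s = F s) (hg : ∀ᵐ s : ℝ, g s = deriv F s) : IsWeakDeriv f g := by
  intro η hη hc
  have h1 : ∫ s, f s * deriv η s = ∫ s, F s * deriv η s :=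
    integral_congr_ae (by filter_upwards [hf] with s hs; rw [hs])
  have h2 : ∫ s, g s * η s = ∫ s, deriv F s * η s :=
    integral_congr_ae (by filter_upwards [hg] with s hs; rw [hs])
  rw [h1, h2, hF.integral_mul_deriv hη hc]

theorem locallyIntegrable_L2R (f : L2R) : LocallyIntegrable f (volume : Measure ℝ) :=
  (Lp.memLp f).locallyIntegrable (by norm_num)

theorem intervalIntegrable_L2R (f : L2R) (a b : ℝ) : IntervalIntegrable f volume a b :=
  intervalIntegrable_iff.mpr <|
    ((locallyIntegrable_L2R f).integrableOn_isCompact isCompact_uIcc).mono_set uIoc_subset_uIcc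

/-- The difference of `f` and a primitive of `g` annihilates all derivatives of test functions,
hence is constant. -/
theorem IsWeakDeriv.exists_locallyAC {f g : L2R} (h : IsWeakDeriv f g) :
    ∃ F : ℝ → ℝ, LocallyAC F ∧ (∀ᵐ s : ℝ, f s = F s) ∧ (∀ᵐ s : ℝ, HasDerivAt F (g s) s) ∧
      ∀ a b, F b - F a = ∫ t in a..b, g t := by
  have hg := locallyIntegrable_L2R g
  have hac := locallyAC_integral hg
  have hder : ∀ᵐ s : ℝ, HasDerivAt (fun x => ∫ t in (0 : ℝ)..x, g t) (g s) s := by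
    filter_upwards [LocallyIntegrable.ae_hasDerivAt_integral hg] with s hs using hs 0
  obtain ⟨c, hc⟩ := ae_const_of_integral_mul_deriv_eq_zero
    (u := fun s => f s - ∫ t in (0 : ℝ)..s, g t)
    ((locallyIntegrable_L2R f).sub hac.continuous.locallyIntegrable) (by
      intro η hη hηc
      have h1 : Integrable fun s => (∫ t in (0 : ℝ)..s, g t) * deriv η s := by
        simpa [mul_comm] using hac.continuous.locallyIntegrable.integrable_smul_left_of_hasCompactSupport
          (hη.continuous_deriv (by simp)) hηc.deriv
      simp_rw [sub_mul]
      rw [integral_sub (integrable_mul_deriv_test f hη hηc) h1, h η hη hηc,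
        hac.integral_mul_deriv hη hηc]
      have h2 : ∫ s, deriv (fun x => ∫ t in (0 : ℝ)..x, g t) s * η s = ∫ s, g s * η s :=
        integral_congr_ae (by filter_upwards [hder] with s hs; rw [hs.deriv])
      rw [h2]
      ring)
  refine ⟨fun x => c + ∫ t in (0 : ℝ)..x, g t, ?_, ?_, ?_, ?_⟩
  · exact hac.of_dist_le fun a b => by simp
  · filter_upwards [hc] with s hs
    linarith
  · filter_upwards [hder] with s hs using hs.const_add c
  · intro a b
    rw [add_sub_add_left_eq_sub]
    exact intervalIntegral.integral_interval_sub_left (intervalIntegrable_L2R g _ _)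
      (intervalIntegrable_L2R g _ _)

/-! ### The supremum bound by the `H¹` norm. -/

theorem integrable_sq_L2R (f : L2R) : Integrable fun s => f s ^ 2 :=
  (Lp.memLp f).integrable_sq

theorem norm_sq_L2R (f : L2R) : ‖f‖ ^ 2 = ∫ s, f s ^ 2 := by
  rw [← real_inner_self_eq_norm_sq, L2.inner_def]
  refine integral_congr_ae (ae_of_all _ fun s => ?_)
  simp [sq]

/-- Cauchy–Schwarz on an interval of length at most one, obtained by expanding `∫ (g - I)² ≥ 0`. -/
theorem intervalIntegral_sq_le {g : L2R} {a b : ℝ} (hab : a ≤ b) (hb : b ≤ a + 1) :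
    (∫ t in a..b, g t) ^ 2 ≤ ∫ t, g t ^ 2 := by
  set I := ∫ t in a..b, g t with hI
  have hi := intervalIntegrable_L2R g a b
  have h2 : IntervalIntegrable (fun t => g t ^ 2) volume a b :=
    (integrable_sq_L2R g).intervalIntegrable
  have h0 : 0 ≤ ∫ t in a..b, (g t - I) ^ 2 :=
    intervalIntegral.integral_nonneg hab fun t _ => sq_nonneg _
  have h1 : ∫ t in a..b, (g t - I) ^ 2 =
      (∫ t in a..b, g t ^ 2) - 2 * I * I + (b - a) * I ^ 2 := by
    have e : (fun t => (g t - I) ^ 2) = fun t => g t ^ 2 - 2 * I * g t + I ^ 2 := by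
      ext t; ring
    rw [e, intervalIntegral.integral_add (h2.sub (hi.const_mul _)) intervalIntegrable_const,
      intervalIntegral.integral_sub h2 (hi.const_mul _), intervalIntegral.integral_const_mul,
      intervalIntegral.integral_const, smul_eq_mul, ← hI]
  have h3 : ∫ t in a..b, g t ^ 2 ≤ ∫ t, g t ^ 2 := by
    rw [intervalIntegral.integral_of_le hab]
    exact setIntegral_le_integral (integrable_sq_L2R g) (ae_of_all _ fun t => sq_nonneg _)
  nlinarith [mul_nonneg (by linarith : 0 ≤ 1 - (b - a)) (sq_nonneg I)]

theorem exists_sq_le_integral {f : L2R} {F : ℝ → ℝ} (hF : Continuous F)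
    (hf : ∀ᵐ s : ℝ, f s = F s) (x : ℝ) : ∃ y ∈ Icc x (x + 1), F y ^ 2 ≤ ∫ s, f s ^ 2 := by
  by_contra! h
  have hi : Integrable fun s => F s ^ 2 :=
    (integrable_sq_L2R f).congr (by filter_upwards [hf] with s hs; rw [hs])
  have he : ∫ s, f s ^ 2 = ∫ s, F s ^ 2 :=
    integral_congr_ae (by filter_upwards [hf] with s hs; rw [hs])
  have h1 : ∫ t in x..(x + 1), F t ^ 2 ≤ ∫ s, f s ^ 2 := by
    rw [intervalIntegral.integral_of_le (by linarith), he]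
    exact setIntegral_le_integral hi (ae_of_all _ fun t => sq_nonneg _)
  have h2 : ∫ t in x..(x + 1), (∫ s, f s ^ 2) < ∫ t in x..(x + 1), F t ^ 2 :=
    intervalIntegral.integral_lt_integral_of_continuousOn_of_le_of_exists_lt (by linarith)
      continuousOn_const (hF.pow 2).continuousOn (fun t ht => (h t (Ioc_subset_Icc_self ht)).le)
      ⟨x, by simp, h x (by simp)⟩
  rw [intervalIntegral.integral_const] at h2
  simp only [add_sub_cancel_left, one_smul] at h2
  linarith

/-- Within distance one of `s` there is a point where `F²` is at most its integral over the line;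
the increment of `F` from there is an integral of `g`. -/
theorem IsWeakDeriv.ae_sq_le {f g : L2R} (h : IsWeakDeriv f g) :
    ∀ᵐ s : ℝ, f s ^ 2 ≤ 2 * (∫ t, f t ^ 2) + 2 * ∫ t, g t ^ 2 := by
  obtain ⟨F, hac, hf, -, hint⟩ := h.exists_locallyAC
  filter_upwards [hf] with s hs
  obtain ⟨y, hy, hyle⟩ := exists_sq_le_integral hac.continuous hf s
  have h1 := intervalIntegral_sq_le (g := g) hy.1 hy.2
  rw [← hint] at h1
  rw [hs]
  nlinarith [sq_nonneg (F y + (F y - F s))]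

/-! ### The quadratic mean of two weakly differentiable functions. -/

/-- The reverse triangle inequality for the Euclidean norm of `(a, b)/√2`. -/
theorem sq_sqrt_sub_sqrt_le (a b c d : ℝ) :
    (√((a ^ 2 + b ^ 2) / 2) - √((c ^ 2 + d ^ 2) / 2)) ^ 2 ≤ ((a - c) ^ 2 + (b - d) ^ 2) / 2 := by
  have h1 := Real.sq_sqrt (by positivity : 0 ≤ (a ^ 2 + b ^ 2) / 2)
  have h2 := Real.sq_sqrt (by positivity : 0 ≤ (c ^ 2 + d ^ 2) / 2)
  have h3 : (a * c + b * d) / 2 ≤ √((a ^ 2 + b ^ 2) / 2) * √((c ^ 2 + d ^ 2) / 2) := by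
    rw [← Real.sqrt_mul (by positivity)]
    apply Real.le_sqrt_of_sq_le
    nlinarith [sq_nonneg (a * d - b * c)]
  nlinarith

/-- The quadratic mean of two functions has a weak derivative whose square is at most the mean of
the squares of the two derivatives. -/
theorem exists_isWeakDeriv_quadraticMean {f₁ f₂ g₁ g₂ : L2R} (h₁ : IsWeakDeriv f₁ g₁)
    (h₂ : IsWeakDeriv f₂ g₂) :
    ∃ v w : L2R, IsWeakDeriv v w ∧ (∀ᵐ s : ℝ, v s = √((f₁ s ^ 2 + f₂ s ^ 2) / 2)) ∧
      ∀ᵐ s : ℝ, w s ^ 2 ≤ (g₁ s ^ 2 + g₂ s ^ 2) / 2 := by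
  obtain ⟨F₁, hac₁, hf₁, hd₁, -⟩ := h₁.exists_locallyAC
  obtain ⟨F₂, hac₂, hf₂, hd₂, -⟩ := h₂.exists_locallyAC
  set V : ℝ → ℝ := fun s => √((F₁ s ^ 2 + F₂ s ^ 2) / 2) with hV
  have hVsq (a b : ℝ) : (V a - V b) ^ 2 ≤ ((F₁ a - F₁ b) ^ 2 + (F₂ a - F₂ b) ^ 2) / 2 :=
    sq_sqrt_sub_sqrt_le _ _ _ _
  have hVac : LocallyAC V := by
    intro a b
    have h1 := hac₁ a b
    have h2 := hac₂ a b
    unfold AbsolutelyContinuousOnInterval at h1 h2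
    have hsum := h1.add h2
    rw [add_zero] at hsum
    refine squeeze_zero (fun E => Finset.sum_nonneg fun _ _ => dist_nonneg)
      (fun E => (Finset.sum_le_sum fun i _ => ?_).trans_eq Finset.sum_add_distrib)
      hsum
    set x := (E.2 i).1
    set y := (E.2 i).2
    rw [Real.dist_eq, Real.dist_eq, Real.dist_eq]
    refine abs_le_of_sq_le_sq ?_ (by positivity)
    have := hVsq x y
    nlinarith [sq_abs (F₁ x - F₁ y), sq_abs (F₂ x - F₂ y),
      mul_nonneg (abs_nonneg (F₁ x - F₁ y)) (abs_nonneg (F₂ x - F₂ y)), sq_nonneg (F₁ x - F₁ y),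
      sq_nonneg (F₂ x - F₂ y)]
  have hder : ∀ᵐ s : ℝ, deriv V s ^ 2 ≤ (g₁ s ^ 2 + g₂ s ^ 2) / 2 := by
    filter_upwards [hVac.ae_differentiableAt, hd₁, hd₂] with s hs h1 h2
    have t0 := (hasDerivAt_iff_tendsto_slope.1 hs.hasDerivAt).pow 2
    have t1 := (hasDerivAt_iff_tendsto_slope.1 h1).pow 2
    have t2 := (hasDerivAt_iff_tendsto_slope.1 h2).pow 2
    -- The bound is passed to the limit from difference quotients, so zeros of `V`, where the square
    -- root is not smooth, need no separate treatment.
    refine le_of_tendsto_of_tendsto t0 ((t1.add t2).div_const 2) ?_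
    filter_upwards with x
    simp only [slope_def_field, div_pow]
    rw [← add_div, div_right_comm]
    exact div_le_div_of_nonneg_right (hVsq x s) (sq_nonneg _)
  have hf₁' := Lp.memLp f₁
  have hf₂' := Lp.memLp f₂
  have hVm : MemLp V 2 volume := by
    refine MemLp.mono' (hf₁'.norm.add hf₂'.norm) hVac.continuous.aestronglyMeasurable ?_
    filter_upwards [hf₁, hf₂] with s h1 h2
    simp only [Pi.add_apply, h1, h2, Real.norm_eq_abs]
    rw [abs_of_nonneg (Real.sqrt_nonneg _)]
    refine Real.sqrt_le_iff.2 ⟨by positivity, ?_⟩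
    nlinarith [sq_abs (F₁ s), sq_abs (F₂ s), mul_nonneg (abs_nonneg (F₁ s)) (abs_nonneg (F₂ s)),
      sq_nonneg (F₁ s), sq_nonneg (F₂ s)]
  have hdm : MemLp (deriv V) 2 volume := by
    refine MemLp.mono' ((Lp.memLp g₁).norm.add (Lp.memLp g₂).norm)
      (measurable_deriv V).aestronglyMeasurable ?_
    filter_upwards [hder] with s hs
    simp only [Pi.add_apply, Real.norm_eq_abs]
    refine abs_le_of_sq_le_sq ?_ (by positivity)
    nlinarith [sq_abs (g₁ s), sq_abs (g₂ s), mul_nonneg (abs_nonneg (g₁ s)) (abs_nonneg (g₂ s)),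
      sq_nonneg (g₁ s), sq_nonneg (g₂ s)]
  refine ⟨hVm.toLp, hdm.toLp, isWeakDeriv_of_locallyAC hVac hVm.coeFn_toLp hdm.coeFn_toLp, ?_, ?_⟩
  · filter_upwards [hVm.coeFn_toLp, hf₁, hf₂] with s h1 h2 h3
    rw [h1, h2, h3]
  · filter_upwards [hdm.coeFn_toLp, hder] with s h1 h2
    rwa [h1]

/-! ### Weak compactness and lower semicontinuity of the norm of `X`. -/

theorem exists_subseq_tendsto_inner {H : Type*} [NormedAddCommGroup H] [InnerProductSpace ℝ H]
    [CompleteSpace H] [TopologicalSpace.SeparableSpace H] {x : ℕ → H} {r : ℝ} (hx : ∀ n, ‖x n‖ ≤ r) :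
    ∃ (y : H) (φ : ℕ → ℕ), StrictMono φ ∧
      ∀ z, Tendsto (fun n => inner ℝ (x (φ n)) z) atTop (𝓝 (inner ℝ y z)) := by
  obtain ⟨l, -, φ, hφ, hl⟩ := WeakDual.isSeqCompact_closedBall ℝ H 0 r
    (x := fun n => StrongDual.toWeakDual (InnerProductSpace.toDual ℝ H (x n)))
    (fun n => by simpa using hx n)
  refine ⟨(InnerProductSpace.toDual ℝ H).symm (WeakDual.toStrongDual l), φ, hφ, fun z => ?_⟩
  rw [InnerProductSpace.toDual_symm_apply]
  exact (tendsto_iff_forall_eval_tendsto_topDualPairing.1 hl) z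

instance instSecondCountableL2R : SecondCountableTopology L2R :=
  haveI : Fact ((2 : ENNReal) ≠ ⊤) := ⟨by norm_num⟩
  inferInstance

theorem inner_toLp_test (f : L2R) {η : ℝ → ℝ} (hη : MemLp η 2 (volume : Measure ℝ)) :
    inner ℝ f hη.toLp = ∫ s, f s * η s := by
  rw [L2.inner_def]
  refine integral_congr_ae ?_
  filter_upwards [hη.coeFn_toLp] with s hs
  simp [hs, mul_comm]

theorem exists_of_isWeakDeriv {f g : L2R} (h : IsWeakDeriv f g)
    (hm : MemLp (fun s : ℝ => s * f s) 2 volume) : ∃ χ : X, toL2 χ = f ∧ wderiv χ = g :=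
  let χ : X := ⟨f, ⟨g, h⟩, hm⟩
  ⟨χ, rfl, (isWeakDeriv_wderiv χ).unique h⟩

theorem norm_sq_X (ψ : X) : ‖ψ‖ ^ 2 = ‖wderiv ψ‖ ^ 2 + ‖mulVar ψ‖ ^ 2 := by
  rw [← real_inner_self_eq_norm_sq, ← real_inner_self_eq_norm_sq, ← real_inner_self_eq_norm_sq]
  rfl

theorem norm_sq_X_eq_integral (ψ : X) :
    ‖ψ‖ ^ 2 = (∫ s, wderiv ψ s ^ 2) + ∫ s, s ^ 2 * ψ s ^ 2 := by
  rw [norm_sq_X, norm_sq_L2R, norm_sq_L2R]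
  congr 1
  refine integral_congr_ae ?_
  filter_upwards [coeFn_mulVar ψ] with s hs
  rw [hs, mul_pow]

theorem norm_wderiv_le (ψ : X) : ‖wderiv ψ‖ ≤ ‖ψ‖ :=
  le_of_sq_le_sq (by rw [norm_sq_X]; nlinarith [sq_nonneg ‖mulVar ψ‖]) (norm_nonneg _)

theorem norm_mulVar_le (ψ : X) : ‖mulVar ψ‖ ≤ ‖ψ‖ :=
  le_of_sq_le_sq (by rw [norm_sq_X]; nlinarith [sq_nonneg ‖wderiv ψ‖]) (norm_nonneg _)

/-- A limit in `L²` of a sequence bounded in `X` lies in `X`, with lower semicontinuity of the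
norm. -/
theorem exists_of_tendsto_toL2 {ψ : ℕ → X} {f : L2R} {r : ℕ → ℝ} {R : ℝ}
    (hf : Tendsto (fun n => toL2 (ψ n)) atTop (𝓝 f)) (hr : ∀ n, ‖ψ n‖ ^ 2 ≤ r n)
    (hR : Tendsto r atTop (𝓝 R)) : ∃ χ : X, toL2 χ = f ∧ ‖χ‖ ^ 2 ≤ R := by
  obtain ⟨B, hB⟩ := hR.bddAbove_range
  have hn (n : ℕ) : ‖ψ n‖ ≤ √B :=
    Real.le_sqrt_of_sq_le ((hr n).trans (hB (mem_range_self n)))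
  obtain ⟨g, φ₁, hφ₁, hg⟩ := exists_subseq_tendsto_inner
    (x := fun n => wderiv (ψ n)) (fun n => (norm_wderiv_le _).trans (hn n))
  obtain ⟨k, φ₂, hφ₂, hk⟩ := exists_subseq_tendsto_inner
    (x := fun n => mulVar (ψ (φ₁ n))) (fun n => (norm_mulVar_le _).trans (hn _))
  have hg' (z : L2R) := (hg z).comp hφ₂.tendsto_atTop
  have hφ : Tendsto (fun n => φ₁ (φ₂ n)) atTop atTop :=
    hφ₁.tendsto_atTop.comp hφ₂.tendsto_atTop
  have hf' (z : L2R) : Tendsto (fun n => inner ℝ (toL2 (ψ (φ₁ (φ₂ n)))) z) atTop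
      (𝓝 (inner ℝ f z)) := (hf.comp hφ).inner tendsto_const_nhds
  have hw : IsWeakDeriv f g := by
    intro η hη hc
    have m0 : MemLp η 2 (volume : Measure ℝ) := hη.continuous.memLp_of_hasCompactSupport hc
    have m1 : MemLp (deriv η) 2 (volume : Measure ℝ) :=
      (hη.continuous_deriv (by simp)).memLp_of_hasCompactSupport hc.deriv
    have t1 := hf' m1.toLp
    have t2 := hg' m0.toLp
    simp only [Function.comp_def, inner_toLp_test] at t1 t2
    refine tendsto_nhds_unique t1 (t2.neg.congr fun n => ?_)
    exact (isWeakDeriv_wderiv (ψ (φ₁ (φ₂ n))) η hη hc).symm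
  -- The weak limit of `s ψ_n` is identified through test functions, for which `s η` is again in
  -- `L²`.
  have hkf : ∀ᵐ s : ℝ, k s = s * f s := by
    refine ae_eq_of_integral_contDiff_smul_eq (locallyIntegrable_L2R k)
      ((locallyIntegrable_L2R f).continuous_mul continuous_id) ?_
    intro η hη hc
    have m0 : MemLp η 2 (volume : Measure ℝ) := hη.continuous.memLp_of_hasCompactSupport hc
    have m1 : MemLp (fun s => s * η s) 2 (volume : Measure ℝ) :=
      (continuous_id.mul hη.continuous).memLp_of_hasCompactSupport hc.mul_left
    have t1 := hf' m1.toLp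
    have t2 := hk m0.toLp
    simp only [inner_toLp_test] at t1 t2
    have e : ∫ s, k s * η s = ∫ s, f s * (s * η s) := by
      refine tendsto_nhds_unique t2 (t1.congr fun n => integral_congr_ae ?_)
      filter_upwards [coeFn_mulVar (ψ (φ₁ (φ₂ n)))] with s hs
      rw [hs]
      ring
    simp only [smul_eq_mul]
    calc ∫ s, η s * k s = ∫ s, k s * η s := by simp_rw [mul_comm]
      _ = _ := e
      _ = _ := by
        congr 1
        ext s
        ring
  obtain ⟨χ, hχ, hχ'⟩ := exists_of_isWeakDeriv hw ((Lp.memLp k).ae_eq hkf)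
  have hχk : mulVar χ = k := by
    apply Lp.ext
    filter_upwards [coeFn_mulVar χ, hkf] with s h1 h2
    rw [h1, h2, hχ]
  refine ⟨χ, hχ, ?_⟩
  have hlim : Tendsto (fun n => inner ℝ (wderiv (ψ (φ₁ (φ₂ n)))) g +
      inner ℝ (mulVar (ψ (φ₁ (φ₂ n)))) k) atTop (𝓝 (inner ℝ g g + inner ℝ k k)) :=
    (hg' g).add (hk k)
  rw [real_inner_self_eq_norm_sq, real_inner_self_eq_norm_sq] at hlim
  -- From `2⟨u, v⟩ ≤ ‖u‖² + ‖v‖²` the limit satisfies `‖g‖² + ‖k‖² ≤ (R + ‖g‖² + ‖k‖²)/2`.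
  have hle := le_of_tendsto_of_tendsto' hlim
    (((hR.comp hφ).add_const (‖g‖ ^ 2 + ‖k‖ ^ 2)).div_const 2) (fun n => by
      have h1 := real_inner_le_norm (wderiv (ψ (φ₁ (φ₂ n)))) g
      have h2 := real_inner_le_norm (mulVar (ψ (φ₁ (φ₂ n)))) k
      have h3 := hr (φ₁ (φ₂ n))
      rw [norm_sq_X] at h3
      simp only [Function.comp_apply]
      nlinarith [sq_nonneg (‖wderiv (ψ (φ₁ (φ₂ n)))‖ - ‖g‖),
        sq_nonneg (‖mulVar (ψ (φ₁ (φ₂ n)))‖ - ‖k‖)])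
  rw [norm_sq_X, hχ', hχk]
  linarith

theorem charge_eq_norm_sq (ψ : X) : charge ψ = ‖toL2 ψ‖ ^ 2 := (norm_sq_L2R _).symm

theorem ae_sq_le (ψ : X) : ∀ᵐ s : ℝ, ψ s ^ 2 ≤ 2 * charge ψ + 2 * ‖ψ‖ ^ 2 := by
  filter_upwards [(isWeakDeriv_wderiv ψ).ae_sq_le] with s hs
  have h1 : ∫ t, wderiv ψ t ^ 2 ≤ ‖ψ‖ ^ 2 := by
    rw [← norm_sq_L2R]
    exact pow_le_pow_left₀ (norm_nonneg _) (norm_wderiv_le ψ) 2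
  unfold charge
  linarith

theorem integrable_weight_sq (ψ : X) : Integrable fun s => s ^ 2 * ψ s ^ 2 :=
  (memLp_mul ψ).integrable_sq.congr (ae_of_all _ fun s => by simp only; ring)

/-- Convexity of the quadratic part of the energy as a function of the density `ψ²`. -/
theorem exists_quadraticMean (φ ψ : X) : ∃ χ : X, (∀ᵐ s : ℝ, χ s = √((φ s ^ 2 + ψ s ^ 2) / 2)) ∧
    ‖χ‖ ^ 2 ≤ (‖φ‖ ^ 2 + ‖ψ‖ ^ 2) / 2 := by
  obtain ⟨v, w, hw, hv, hle⟩ :=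
    exists_isWeakDeriv_quadraticMean (isWeakDeriv_wderiv φ) (isWeakDeriv_wderiv ψ)
  have hm : MemLp (fun s : ℝ => s * v s) 2 volume := by
    refine MemLp.mono' ((memLp_mul φ).norm.add (memLp_mul ψ).norm)
      (measurable_id.aestronglyMeasurable.mul (Lp.aestronglyMeasurable v)) ?_
    filter_upwards [hv] with s h1
    simp only [Pi.add_apply, Real.norm_eq_abs, abs_mul]
    rw [← mul_add, h1, abs_of_nonneg (Real.sqrt_nonneg _)]
    refine mul_le_mul_of_nonneg_left (Real.sqrt_le_iff.2 ⟨by positivity, ?_⟩) (abs_nonneg s)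
    nlinarith [sq_abs (φ s), sq_abs (ψ s), mul_nonneg (abs_nonneg (φ s)) (abs_nonneg (ψ s)),
      sq_nonneg (φ s), sq_nonneg (ψ s)]
  obtain ⟨χ, rfl, rfl⟩ := exists_of_isWeakDeriv hw hm
  refine ⟨χ, hv, ?_⟩
  rw [norm_sq_X_eq_integral, norm_sq_X_eq_integral, norm_sq_X_eq_integral]
  have h1 : ∫ s, wderiv χ s ^ 2 ≤ ((∫ s, wderiv φ s ^ 2) + ∫ s, wderiv ψ s ^ 2) / 2 := by
    rw [← integral_add (integrable_sq_L2R _) (integrable_sq_L2R _), ← integral_div]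
    exact integral_mono_ae (integrable_sq_L2R _)
      (((integrable_sq_L2R _).add (integrable_sq_L2R _)).div_const 2) hle
  have h2 : ∫ s, s ^ 2 * χ s ^ 2 =
      ((∫ s, s ^ 2 * φ s ^ 2) + ∫ s, s ^ 2 * ψ s ^ 2) / 2 := by
    rw [← integral_add (integrable_weight_sq _) (integrable_weight_sq _), ← integral_div]
    refine integral_congr_ae ?_
    filter_upwards [hv] with s hs
    rw [hs, Real.sq_sqrt (by positivity)]
    ring
  linarith

/-! ### The harmonic oscillator and its Gaussian ground state. -/

/-- `H(R) - H(-R)` tends to the integral of `H'` and is integrable in `R`, so its limit is zero. -/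
theorem LocallyAC.integral_deriv_eq_zero {H : ℝ → ℝ} (hH : LocallyAC H) (hi : Integrable H)
    (hd : Integrable (deriv H)) : ∫ s, deriv H s = 0 := by
  have h1 : Tendsto (fun R : ℝ => ∫ s in (-R)..R, deriv H s) atTop (𝓝 (∫ s, deriv H s)) :=
    intervalIntegral_tendsto_integral hd tendsto_neg_atTop_atBot tendsto_id
  have h2 : Tendsto (fun R : ℝ => H R - H (-R)) atTop (𝓝 (∫ s, deriv H s)) :=
    h1.congr fun R => (hH _ _).integral_deriv_eq_sub
  have h3 : Integrable fun R : ℝ => H R - H (-R) := hi.sub hi.comp_neg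
  refine IntegrableAtFilter.eq_zero_of_tendsto (μ := volume) (l := atTop)
    (h3.integrableAtFilter _) (fun s hs => ?_) h2
  obtain ⟨b, hb⟩ := mem_atTop_sets.1 hs
  exact top_le_iff.1 (Real.volume_Ici (a := b) ▸ measure_mono fun x hx => hb x hx)

theorem integrable_mul_L2R (f g : L2R) : Integrable fun s => f s * g s :=
  (Lp.memLp f).integrable_mul (Lp.memLp g)

/-- The integrand is the derivative of `s ψ²`, which is integrable as the product of `sψ` and `ψ`.
-/
theorem integral_mul_mul_wderiv (ψ : X) :
    ∫ s, (2 * (s * ψ s * wderiv ψ s) + ψ s ^ 2) = 0 := by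
  obtain ⟨F, hac, hf, hd, -⟩ := (isWeakDeriv_wderiv ψ).exists_locallyAC
  have hid : LocallyAC fun s => s := locallyAC_of_contDiff contDiff_id
  have hder : ∀ᵐ s : ℝ, deriv (fun s => s * (F s * F s)) s =
      2 * (s * ψ s * wderiv ψ s) + ψ s ^ 2 := by
    filter_upwards [hf, hd] with s h1 h2
    have := ((hasDerivAt_id s).mul (h2.mul h2)).deriv
    simp only [Pi.mul_def, id] at this
    rw [this, h1]
    ring
  have hi : Integrable fun s => 2 * (s * ψ s * wderiv ψ s) + ψ s ^ 2 := by
    refine Integrable.add (Integrable.const_mul ?_ _) (integrable_sq_L2R _)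
    refine (integrable_mul_L2R (mulVar ψ) (wderiv ψ)).congr ?_
    filter_upwards [coeFn_mulVar ψ] with s hs
    rw [hs]
  rw [← integral_congr_ae hder]
  refine (hid.mul (hac.mul hac)).integral_deriv_eq_zero ?_ (hi.congr (by filter_upwards [hder] with s hs using hs.symm))
  refine (integrable_mul_L2R (mulVar ψ) (toL2 ψ)).congr ?_
  filter_upwards [coeFn_mulVar ψ, hf] with s h1 h2
  rw [h1, h2]
  ring

/-- The factorization of the harmonic oscillator. -/
theorem norm_sq_sub_charge (ψ : X) :
    ‖ψ‖ ^ 2 - charge ψ = ∫ s, (wderiv ψ s + mulVar ψ s) ^ 2 := by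
  have e : ∫ s, (wderiv ψ s + mulVar ψ s) ^ 2 =
      ∫ s, (wderiv ψ s ^ 2 + mulVar ψ s ^ 2 + 2 * (mulVar ψ s * wderiv ψ s)) := by
    congr 1
    ext s
    ring
  have h : ∫ s, 2 * (mulVar ψ s * wderiv ψ s) = -charge ψ := by
    have h0 := integral_mul_mul_wderiv ψ
    have h1 : ∫ s, (2 * (s * ψ s * wderiv ψ s) + ψ s ^ 2) =
        ∫ s, (2 * (mulVar ψ s * wderiv ψ s) + ψ s ^ 2) := by
      refine integral_congr_ae ?_
      filter_upwards [coeFn_mulVar ψ] with s hs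
      rw [hs]
    rw [h1, integral_add ((integrable_mul_L2R _ _).const_mul _) (integrable_sq_L2R _)] at h0
    unfold charge
    linarith
  have i1 : Integrable fun s => wderiv ψ s ^ 2 + mulVar ψ s ^ 2 :=
    (integrable_sq_L2R _).add (integrable_sq_L2R _)
  rw [e, integral_add i1
    ((integrable_mul_L2R _ _).const_mul _), integral_add (integrable_sq_L2R _)
    (integrable_sq_L2R _), h, norm_sq_X, norm_sq_L2R, norm_sq_L2R]
  ring

theorem charge_le_norm_sq (ψ : X) : charge ψ ≤ ‖ψ‖ ^ 2 := by
  have := norm_sq_sub_charge ψ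
  have h : 0 ≤ ∫ s, (wderiv ψ s + mulVar ψ s) ^ 2 := integral_nonneg fun s => sq_nonneg _
  linarith

theorem hasDerivAt_exp_mul_sq (c s : ℝ) :
    HasDerivAt (fun s : ℝ => Real.exp (c * s ^ 2)) (Real.exp (c * s ^ 2) * (c * (2 * s))) s := by
  have h : HasDerivAt (fun s : ℝ => c * s ^ 2) (c * (2 * s)) s := by
    simpa using (hasDerivAt_pow 2 s).const_mul c
  exact h.exp

/-- Equality forces `ψ' + sψ = 0`, so `ψ exp(s²/2)` has zero derivative. -/
theorem exists_eq_gaussian_of_norm_sq_eq {ψ : X} (h : ‖ψ‖ ^ 2 = charge ψ) :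
    ∃ c : ℝ, ∀ᵐ s : ℝ, ψ s = c * Real.exp (-1 / 2 * s ^ 2) := by
  obtain ⟨F, hac, hf, hd, -⟩ := (isWeakDeriv_wderiv ψ).exists_locallyAC
  have h0 : ∫ s, (wderiv ψ s + mulVar ψ s) ^ 2 = 0 := by rw [← norm_sq_sub_charge, h, sub_self]
  have hi : Integrable fun s => (wderiv ψ s + mulVar ψ s) ^ 2 :=
    ((Lp.memLp (wderiv ψ)).add (Lp.memLp (mulVar ψ))).integrable_sq
  have hz : ∀ᵐ s : ℝ, wderiv ψ s + mulVar ψ s = 0 := by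
    filter_upwards [(integral_eq_zero_iff_of_nonneg (fun s => sq_nonneg _) hi).1 h0] with s hs
    exact pow_eq_zero_iff two_ne_zero |>.1 hs
  have hE : LocallyAC fun s => Real.exp (1 / 2 * s ^ 2) :=
    locallyAC_of_contDiff (by fun_prop)
  have hder : ∀ᵐ s : ℝ, HasDerivAt (fun s => F s * Real.exp (1 / 2 * s ^ 2)) 0 s := by
    filter_upwards [hz, hf, hd, coeFn_mulVar ψ] with s h1 h2 h3 h4
    have h6 : wderiv ψ s + s * F s = 0 := by rw [← h2, ← h4, h1]
    have h7 := h3.mul (hasDerivAt_exp_mul_sq (1 / 2) s)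
    have h8 : wderiv ψ s * Real.exp (1 / 2 * s ^ 2) +
        F s * (Real.exp (1 / 2 * s ^ 2) * (1 / 2 * (2 * s))) = 0 := by
      linear_combination Real.exp (1 / 2 * s ^ 2) * h6
    rwa [h8] at h7
  have hconst : ∀ x, F x * Real.exp (1 / 2 * x ^ 2) = F 0 := by
    intro x
    have h1 : ∀ᵐ s : ℝ, s ∈ uIcc 0 x →
        HasDerivAt (fun s => F s * Real.exp (1 / 2 * s ^ 2)) 0 s := by
      filter_upwards [hder] with s hs _ using hs
    obtain ⟨c, hc⟩ := (hac.mul hE 0 x).const_of_ae_hasDerivAt_zero h1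
    have h2 := hc x right_mem_uIcc
    have h3 := hc 0 left_mem_uIcc
    simp only [ne_eq, OfNat.ofNat_ne_zero, not_false_eq_true, zero_pow, mul_zero, Real.exp_zero,
      mul_one] at h3
    rw [h2, h3]
  refine ⟨F 0, ?_⟩
  filter_upwards [hf] with s hs
  rw [hs, ← hconst s, mul_assoc, ← Real.exp_add]
  ring_nf
  simp

theorem charge_smul (c : ℝ) (ψ : X) : charge (c • ψ) = c ^ 2 * charge ψ := by
  rw [charge_eq_norm_sq, charge_eq_norm_sq, map_smul, norm_smul, mul_pow, Real.norm_eq_abs, sq_abs]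

theorem coeFn_smul_X (c : ℝ) (ψ : X) : ∀ᵐ s : ℝ, (c • ψ) s = c * ψ s := by
  rw [map_smul]
  exact Lp.coeFn_smul c (toL2 ψ)

theorem coeFn_add_X (φ ψ : X) : ∀ᵐ s : ℝ, (φ + ψ) s = φ s + ψ s := by
  rw [map_add]
  exact Lp.coeFn_add (toL2 φ) (toL2 ψ)

theorem ext_X {φ ψ : X} (h : ∀ᵐ s : ℝ, φ s = ψ s) : φ = ψ :=
  toL2_injective (Lp.ext h)

/-- The normalized Gaussian. -/
theorem exists_harmonic_groundState :
    ∃ ψ : X, charge ψ = 1 ∧ ‖ψ‖ ^ 2 = 1 ∧ ∀ᵐ s : ℝ, 0 ≤ ψ s := by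
  set F : ℝ → ℝ := fun s => Real.exp (-1 / 2 * s ^ 2) with hF
  have hFc : Continuous F := by fun_prop
  have hac : LocallyAC F := locallyAC_of_contDiff (by fun_prop)
  have hsq (s : ℝ) : F s ^ 2 = Real.exp (-1 * s ^ 2) := by
    rw [hF, sq, ← Real.exp_add]
    ring_nf
  have hder (s : ℝ) : deriv F s = -(s * F s) := by
    rw [(hasDerivAt_exp_mul_sq (-1 / 2) s).deriv, hF]
    ring
  have hm : MemLp F 2 volume := by
    rw [memLp_two_iff_integrable_sq hFc.aestronglyMeasurable]
    simp_rw [hsq]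
    exact integrable_exp_neg_mul_sq one_pos
  have hsm : MemLp (fun s => s * F s) 2 volume := by
    have hc : Continuous fun s => s * F s := by fun_prop
    rw [memLp_two_iff_integrable_sq hc.aestronglyMeasurable]
    simp_rw [mul_pow, hsq]
    simpa using integrable_rpow_mul_exp_neg_mul_sq one_pos (s := 2) (by norm_num)
  have hw : IsWeakDeriv hm.toLp hsm.neg.toLp := by
    refine isWeakDeriv_of_locallyAC hac hm.coeFn_toLp ?_
    filter_upwards [hsm.neg.coeFn_toLp] with s hs
    rw [hs, hder]
    rfl
  have hm' : MemLp (fun s => s * (hm.toLp : L2R) s) 2 volume := by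
    refine hsm.ae_eq ?_
    filter_upwards [hm.coeFn_toLp] with s hs
    rw [hs]
  obtain ⟨χ, hχ, hχ'⟩ := exists_of_isWeakDeriv hw hm'
  have hval : ∀ᵐ s : ℝ, χ s = F s := by
    rw [hχ]
    exact hm.coeFn_toLp
  have heq : ‖χ‖ ^ 2 = charge χ := by
    have : ∫ s, (wderiv χ s + mulVar χ s) ^ 2 = 0 := by
      refine integral_eq_zero_of_ae ?_
      filter_upwards [coeFn_mulVar χ, hval, hsm.neg.coeFn_toLp] with s h1 h2 h3
      rw [h1, h2, hχ', h3]
      simp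
    rw [← norm_sq_sub_charge] at this
    linarith
  have hpos : 0 < charge χ := by
    have h0 : χ ≠ 0 := by
      rintro rfl
      have h2 : ∀ᵐ s : ℝ, (0 : X) s = 0 := by
        rw [map_zero]
        exact Lp.coeFn_zero ℝ 2 volume
      have : ∀ᵐ _ : ℝ, False := by
        filter_upwards [hval, h2] with s h1 h2
        rw [h2] at h1
        exact (Real.exp_pos _).ne h1
      exact this.exists.choose_spec
    rw [← heq]
    have := norm_pos_iff.2 h0
    positivity
  refine ⟨(√(charge χ))⁻¹ • χ, ?_, ?_, ?_⟩
  · rw [charge_smul, inv_pow, Real.sq_sqrt hpos.le, inv_mul_cancel₀ hpos.ne']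
  · rw [norm_smul, mul_pow, Real.norm_eq_abs, sq_abs, heq, inv_pow, Real.sq_sqrt hpos.le,
      inv_mul_cancel₀ hpos.ne']
  · filter_upwards [coeFn_smul_X (√(charge χ))⁻¹ χ, hval] with s h1 h2
    rw [h1, h2]
    positivity

/-! ### Pointwise inequalities for the interaction density. -/

theorem one_le_sqrt_one_add {lam x : ℝ} (hl : 0 ≤ lam) (hx : 0 ≤ x) : 1 ≤ √(1 + 2 * lam * x) :=
  Real.one_le_sqrt.2 (by nlinarith [mul_nonneg hl hx])

theorem sq_sqrt_one_add {lam x : ℝ} (hl : 0 ≤ lam) (hx : 0 ≤ x) :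
    √(1 + 2 * lam * x) ^ 2 = 1 + 2 * lam * x :=
  Real.sq_sqrt (by nlinarith [mul_nonneg hl hx])

/-- Concavity in `λ`: with `a`, `b` the two roots, `b ≤ a + (b² - a²)/(2a)` because `(a - b)² ≥ 0`.
-/
theorem sqrt_mul_le_tangent {lam lam' x : ℝ} (hl : 0 ≤ lam) (hl' : 0 ≤ lam') (hx : 0 ≤ x) :
    √(1 + 2 * lam' * x) * x ≤
      √(1 + 2 * lam * x) * x + (lam' - lam) * (x ^ 2 / √(1 + 2 * lam * x)) := by
  have ha := one_le_sqrt_one_add hl hx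
  have ha2 := sq_sqrt_one_add hl hx
  have hb2 := sq_sqrt_one_add hl' hx
  set a := √(1 + 2 * lam * x)
  set b := √(1 + 2 * lam' * x)
  have ha0 : 0 < a := by linarith
  have h : (lam' - lam) * (x ^ 2 / a) = x * ((b ^ 2 - a ^ 2) / (2 * a)) := by
    rw [ha2, hb2]
    field_simp
    ring
  have h2 : b ≤ a + (b ^ 2 - a ^ 2) / (2 * a) := by
    rw [← sub_le_iff_le_add', le_div_iff₀ (by positivity)]
    nlinarith [sq_nonneg (a - b)]
  rw [h]
  nlinarith [mul_le_mul_of_nonneg_left h2 hx]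

/-- Convexity in the density with an explicit quadratic gain. What remains has the sign of `(y -
m)(y w - m v)`, which is nonnegative because `ρ/√(1 + 2λρ)` is nondecreasing. -/
theorem tangent_le_sqrt_mul {lam y m : ℝ} (hl : 0 ≤ lam) (hy : 0 ≤ y) (hm : 0 ≤ m) :
    √(1 + 2 * lam * m) * m + (1 + 3 * lam * m) / √(1 + 2 * lam * m) * (y - m) +
      lam * (y - m) ^ 2 / (√(1 + 2 * lam * y) + √(1 + 2 * lam * m)) ≤ √(1 + 2 * lam * y) * y := by
  have hw := one_le_sqrt_one_add hl hm
  have hw2 := sq_sqrt_one_add hl hm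
  have hv := one_le_sqrt_one_add hl hy
  have hv2 := sq_sqrt_one_add hl hy
  set w := √(1 + 2 * lam * m)
  set v := √(1 + 2 * lam * y)
  have hw0 : 0 < w := by linarith
  have hv0 : 0 < v := by linarith
  have hsq : (y * w) ^ 2 - (m * v) ^ 2 = (y - m) * (y + m + 2 * lam * (y * m)) := by
    rw [mul_pow, mul_pow, hw2, hv2]
    ring
  have hp : 0 ≤ y + m + 2 * lam * (y * m) := by positivity
  have key : 0 ≤ (y - m) * (y * w - m * v) := by
    rcases le_total m y with h | h
    · refine mul_nonneg (by linarith) (sub_nonneg.2 (le_of_sq_le_sq ?_ (by positivity)))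
      nlinarith [mul_nonneg (sub_nonneg.2 h) hp]
    · refine mul_nonneg_of_nonpos_of_nonpos (by linarith)
        (sub_nonpos.2 (le_of_sq_le_sq ?_ (by positivity)))
      nlinarith [mul_nonneg (sub_nonneg.2 h) hp]
  have h1 : v - w = 2 * lam * (y - m) / (v + w) := by
    rw [eq_div_iff (by positivity)]
    nlinarith
  have h2 : (1 + 3 * lam * m) / w = w + lam * m / w := by
    rw [div_eq_iff hw0.ne', add_mul, div_mul_cancel₀ _ hw0.ne']
    nlinarith
  have h3 : v * y - w * m = (v - w) * y + w * (y - m) := by ring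
  have h4 : v * y - (w * m + (w + lam * m / w) * (y - m) + lam * (y - m) ^ 2 / (v + w)) =
      lam * ((y - m) * (y * w - m * v)) / (w * (v + w)) := by
    have : v * y = w * m + 2 * lam * (y - m) / (v + w) * y + w * (y - m) := by
      rw [← h1]; ring
    rw [this]
    field_simp
    ring
  rw [h2, ← sub_nonneg, h4]
  positivity

/-- The tangent inequality at the midpoint is averaged over both endpoints, where the linear terms
cancel. The `8` combines `((x - y)/2)²` with the bound `2√(1 + 2λM)` on the sum of the roots. -/
theorem sqrt_mul_midpoint_le {lam x y M : ℝ} (hl : 0 ≤ lam) (hx : 0 ≤ x) (hy : 0 ≤ y)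
    (hxM : x ≤ M) (hyM : y ≤ M) :
    √(1 + 2 * lam * ((x + y) / 2)) * ((x + y) / 2) ≤
      (√(1 + 2 * lam * x) * x + √(1 + 2 * lam * y) * y) / 2 -
        lam / (8 * √(1 + 2 * lam * M)) * (x - y) ^ 2 := by
  set m := (x + y) / 2 with hmdef
  have hm : 0 ≤ m := by positivity
  have hmM : m ≤ M := by linarith
  have hmono {z : ℝ} (hz : z ≤ M) : √(1 + 2 * lam * z) ≤ √(1 + 2 * lam * M) :=
    Real.sqrt_le_sqrt (by nlinarith)
  have hW := one_le_sqrt_one_add hl (hx.trans hxM)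
  have main {z : ℝ} (hz : 0 ≤ z) (hzM : z ≤ M) :
      √(1 + 2 * lam * m) * m + (1 + 3 * lam * m) / √(1 + 2 * lam * m) * (z - m) +
        lam * (z - m) ^ 2 / (2 * √(1 + 2 * lam * M)) ≤ √(1 + 2 * lam * z) * z := by
    refine le_trans ?_ (tangent_le_sqrt_mul hl hz hm)
    have h1 := one_le_sqrt_one_add hl hz
    have h2 := one_le_sqrt_one_add hl hm
    have : lam * (z - m) ^ 2 / (2 * √(1 + 2 * lam * M)) ≤
        lam * (z - m) ^ 2 / (√(1 + 2 * lam * z) + √(1 + 2 * lam * m)) := by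
      refine div_le_div_of_nonneg_left (by positivity) (by linarith) ?_
      linarith [hmono hzM, hmono hmM]
    linarith
  have hxx := main hx hxM
  have hyy := main hy hyM
  have e1 : x - m = (x - y) / 2 := by rw [hmdef]; ring
  have e2 : y - m = -((x - y) / 2) := by rw [hmdef]; ring
  rw [e1] at hxx
  rw [e2, neg_sq] at hyy
  have e3 : lam * ((x - y) / 2) ^ 2 / (2 * √(1 + 2 * lam * M)) =
      lam / (8 * √(1 + 2 * lam * M)) * (x - y) ^ 2 := by
    field_simp
    ring
  rw [e3] at hxx hyy
  linarith

/-- The root is replaced by its tangent at `r²`, an upper bound by concavity. This is the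
second-order control needed for the first variation. -/
theorem sqrt_mul_le_quadratic {lam r δ : ℝ} (hl : 0 ≤ lam) :
    √(1 + 2 * lam * (r + δ) ^ 2) * (r + δ) ^ 2 ≤ √(1 + 2 * lam * r ^ 2) * r ^ 2 +
      nonlin lam r * (2 * r * δ + δ ^ 2) + lam * (2 * r * δ + δ ^ 2) ^ 2 := by
  have hw := one_le_sqrt_one_add hl (sq_nonneg r)
  have hw2 := sq_sqrt_one_add hl (sq_nonneg r)
  have hv2 := sq_sqrt_one_add hl (sq_nonneg (r + δ))
  unfold nonlin
  set w := √(1 + 2 * lam * r ^ 2)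
  set v := √(1 + 2 * lam * (r + δ) ^ 2)
  set x := r ^ 2 with hx
  set e := 2 * r * δ + δ ^ 2 with he
  have hy : (r + δ) ^ 2 = x + e := by rw [hx, he]; ring
  have hx0 : 0 ≤ x := sq_nonneg r
  have hxe : 0 ≤ x + e := hy ▸ sq_nonneg _
  rw [hy] at hv2 ⊢
  have hw0 : 0 < w := by linarith
  have h1 : v ≤ w + lam * e / w := by
    rw [← sub_le_iff_le_add', le_div_iff₀ hw0]
    nlinarith [sq_nonneg (v - w)]
  have h2 : (1 + 3 * lam * x) / w = w + lam * x / w := by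
    rw [div_eq_iff hw0.ne', add_mul, div_mul_cancel₀ _ hw0.ne']
    nlinarith
  have h3 : lam * e ^ 2 / w ≤ lam * e ^ 2 := div_le_self (by positivity) hw
  have h4 : (w + lam * e / w) * (x + e) =
      w * x + (w + lam * x / w) * e + lam * e ^ 2 / w := by
    field_simp
    ring
  rw [h2]
  nlinarith [mul_le_mul_of_nonneg_right h1 hxe]

theorem nonlin_nonneg {lam : ℝ} (hl : 0 ≤ lam) (r : ℝ) : 0 ≤ nonlin lam r := by
  unfold nonlin
  positivity

theorem nonlin_le {lam M r : ℝ} (hl : 0 ≤ lam) (hr : r ^ 2 ≤ M) :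
    nonlin lam r ≤ 1 + 3 * lam * M := by
  unfold nonlin
  refine (div_le_self (by positivity) (one_le_sqrt_one_add hl (sq_nonneg r))).trans ?_
  nlinarith

theorem continuous_nonlin {lam : ℝ} (hl : 0 ≤ lam) : Continuous (nonlin lam) := by
  unfold nonlin
  refine Continuous.div (by fun_prop) (by fun_prop) fun r => ?_
  have := one_le_sqrt_one_add hl (sq_nonneg r)
  linarith

/-- `x²/√(1 + 2λx)` is nondecreasing and increases no faster than `x²`. -/
theorem abs_sq_div_sqrt_sub_le {lam x y : ℝ} (hl : 0 ≤ lam) (hx : 0 ≤ x) (hy : 0 ≤ y) :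
    |x ^ 2 / √(1 + 2 * lam * x) - y ^ 2 / √(1 + 2 * lam * y)| ≤ |x - y| * (x + y) := by
  wlog h : y ≤ x generalizing x y
  · rw [abs_sub_comm, abs_sub_comm x, add_comm x]
    exact this hy hx (le_of_not_ge h)
  have ha := one_le_sqrt_one_add hl hx
  have ha2 := sq_sqrt_one_add hl hx
  have hb := one_le_sqrt_one_add hl hy
  have hb2 := sq_sqrt_one_add hl hy
  have hab : √(1 + 2 * lam * y) ≤ √(1 + 2 * lam * x) := Real.sqrt_le_sqrt (by nlinarith)
  set a := √(1 + 2 * lam * x)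
  set b := √(1 + 2 * lam * y)
  have ha0 : 0 < a := by linarith
  have hb0 : 0 < b := by linarith
  rw [abs_of_nonneg (sub_nonneg.2 h), abs_le]
  constructor
  · have h1 : y ^ 2 / b ≤ x ^ 2 / a := by
      rw [div_le_div_iff₀ hb0 ha0]
      have h2 : y * a ≤ x * b := by
        refine le_of_sq_le_sq ?_ (by positivity)
        rw [mul_pow, mul_pow, ha2, hb2]
        nlinarith [mul_nonneg (mul_nonneg hl (mul_nonneg hx hy)) (sub_nonneg.2 h)]
      nlinarith [mul_le_mul h h2 (by positivity) hx]
    nlinarith [mul_nonneg (sub_nonneg.2 h) (add_nonneg hx hy)]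
  · have h1 : x ^ 2 / a ≤ x ^ 2 / b := div_le_div_of_nonneg_left (by positivity) hb0 hab
    have h2 : (x ^ 2 - y ^ 2) / b ≤ x ^ 2 - y ^ 2 := div_le_self (by nlinarith) hb
    rw [sub_div] at h2
    nlinarith

theorem abs_sq_div_sqrt_sub_le_param {lam lam' x : ℝ} (hl : 0 ≤ lam) (hl' : 0 ≤ lam')
    (hx : 0 ≤ x) :
    |x ^ 2 / √(1 + 2 * lam * x) - x ^ 2 / √(1 + 2 * lam' * x)| ≤ |lam - lam'| * x ^ 3 := by
  wlog h : lam ≤ lam' generalizing lam lam'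
  · rw [abs_sub_comm, abs_sub_comm lam]
    exact this hl' hl (le_of_not_ge h)
  have ha := one_le_sqrt_one_add hl hx
  have ha2 := sq_sqrt_one_add hl hx
  have hb := one_le_sqrt_one_add hl' hx
  have hb2 := sq_sqrt_one_add hl' hx
  have hab : √(1 + 2 * lam * x) ≤ √(1 + 2 * lam' * x) := Real.sqrt_le_sqrt (by nlinarith)
  set a := √(1 + 2 * lam * x)
  set b := √(1 + 2 * lam' * x)
  have ha0 : 0 < a := by linarith
  have hb0 : 0 < b := by linarith
  rw [abs_sub_comm lam, abs_of_nonneg (sub_nonneg.2 h), abs_of_nonneg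
    (sub_nonneg.2 (div_le_div_of_nonneg_left (sq_nonneg x) ha0 hab))]
  have h1 : b - a ≤ (lam' - lam) * x := by nlinarith
  have h2 : x ^ 2 / a - x ^ 2 / b = x ^ 2 * ((b - a) / (a * b)) := by
    field_simp
  have h3 : (b - a) / (a * b) ≤ b - a := div_le_self (by linarith) (by nlinarith)
  rw [h2]
  nlinarith [mul_le_mul_of_nonneg_left (h3.trans h1) (sq_nonneg x)]

/-! ### Energy integrals and strong convexity in the density. -/

/-- The interaction term `∫ √(1 + 2 λ ψ²) ψ² ds` of the energy. -/
def nonlinEnergy (lam : ℝ) (ψ : X) : ℝ := ∫ s, √(1 + 2 * lam * ψ s ^ 2) * ψ s ^ 2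

/-- The integral `∫ ψ⁴ / √(1 + 2 λ ψ²) ds`, the derivative of `nonlinEnergy` in `λ`. -/
def quartic (lam : ℝ) (ψ : X) : ℝ := ∫ s, ψ s ^ 4 / √(1 + 2 * lam * ψ s ^ 2)

theorem energy_eq (C lam : ℝ) (ψ : X) : energy C lam ψ = ‖ψ‖ ^ 2 + C * nonlinEnergy lam ψ := by
  rw [norm_sq_X_eq_integral]
  rfl

theorem exists_sq_bound (ψ : X) : ∃ M : ℝ, 0 ≤ M ∧ ∀ᵐ s : ℝ, ψ s ^ 2 ≤ M :=
  ⟨2 * charge ψ + 2 * ‖ψ‖ ^ 2, by rw [charge_eq_norm_sq]; positivity, ae_sq_le ψ⟩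

theorem aestronglyMeasurable_X (ψ : X) : AEStronglyMeasurable ψ (volume : Measure ℝ) :=
  Lp.aestronglyMeasurable (toL2 ψ)

theorem integrable_sq_X (ψ : X) : Integrable fun s => ψ s ^ 2 := integrable_sq_L2R (toL2 ψ)

theorem integrable_comp_X {ψ : X} {F : ℝ → ℝ} (hF : Continuous F) {M K : ℝ}
    (hM : ∀ᵐ s : ℝ, ψ s ^ 2 ≤ M) (h : ∀ r, r ^ 2 ≤ M → |F r| ≤ K * r ^ 2) :
    Integrable fun s => F (ψ s) := by
  refine ((integrable_sq_X ψ).const_mul K).mono'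
    (hF.comp_aestronglyMeasurable (aestronglyMeasurable_X ψ)) ?_
  filter_upwards [hM] with s hs
  exact h _ hs

theorem integrable_nonlinEnergy {lam : ℝ} (hl : 0 ≤ lam) (ψ : X) :
    Integrable fun s => √(1 + 2 * lam * ψ s ^ 2) * ψ s ^ 2 := by
  obtain ⟨M, -, hM⟩ := exists_sq_bound ψ
  refine integrable_comp_X (F := fun r => √(1 + 2 * lam * r ^ 2) * r ^ 2)
    (K := √(1 + 2 * lam * M)) (by fun_prop) hM fun r hr => ?_
  rw [abs_of_nonneg (by positivity)]
  exact mul_le_mul_of_nonneg_right (Real.sqrt_le_sqrt (by nlinarith)) (sq_nonneg r)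

theorem continuous_quartic_integrand {lam : ℝ} (hl : 0 ≤ lam) :
    Continuous fun r : ℝ => r ^ 4 / √(1 + 2 * lam * r ^ 2) := by
  refine Continuous.div (by fun_prop) (by fun_prop) fun r => ?_
  have := one_le_sqrt_one_add hl (sq_nonneg r)
  linarith

theorem integrable_quartic {lam : ℝ} (hl : 0 ≤ lam) (ψ : X) :
    Integrable fun s => ψ s ^ 4 / √(1 + 2 * lam * ψ s ^ 2) := by
  obtain ⟨M, -, hM⟩ := exists_sq_bound ψ
  refine integrable_comp_X (K := M) (continuous_quartic_integrand hl) hM fun r hr => ?_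
  rw [abs_of_nonneg (by positivity)]
  refine (div_le_self (by positivity) (one_le_sqrt_one_add hl (sq_nonneg r))).trans ?_
  nlinarith [sq_nonneg r]

theorem quartic_nonneg (lam : ℝ) (ψ : X) : 0 ≤ quartic lam ψ :=
  integral_nonneg fun s => by positivity

theorem charge_le_nonlinEnergy {lam : ℝ} (hl : 0 ≤ lam) (ψ : X) :
    charge ψ ≤ nonlinEnergy lam ψ := by
  refine integral_mono (integrable_sq_X ψ) (integrable_nonlinEnergy hl ψ) fun s => ?_
  exact le_mul_of_one_le_left (sq_nonneg _) (one_le_sqrt_one_add hl (sq_nonneg _))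

theorem nonlinEnergy_nonneg (lam : ℝ) (ψ : X) : 0 ≤ nonlinEnergy lam ψ :=
  integral_nonneg fun s => by positivity

theorem charge_nonneg (ψ : X) : 0 ≤ charge ψ := integral_nonneg fun _ => sq_nonneg _

theorem nonlinEnergy_zero (ψ : X) : nonlinEnergy 0 ψ = charge ψ := by
  simp [nonlinEnergy, charge]

theorem norm_sq_le_energy {C : ℝ} (hC : 0 < C) (lam : ℝ) (ψ : X) : ‖ψ‖ ^ 2 ≤ energy C lam ψ := by
  rw [energy_eq]
  have := nonlinEnergy_nonneg lam ψ
  nlinarith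

theorem nonlinEnergy_le_tangent {lam lam' : ℝ} (hl : 0 ≤ lam) (hl' : 0 ≤ lam') (ψ : X) :
    nonlinEnergy lam' ψ ≤ nonlinEnergy lam ψ + (lam' - lam) * quartic lam ψ := by
  unfold nonlinEnergy quartic
  rw [← integral_const_mul, ← integral_add (integrable_nonlinEnergy hl ψ)
    ((integrable_quartic hl ψ).const_mul _)]
  refine integral_mono (integrable_nonlinEnergy hl' ψ) ((integrable_nonlinEnergy hl ψ).add
    ((integrable_quartic hl ψ).const_mul _)) fun s => ?_
  have := sqrt_mul_le_tangent hl hl' (sq_nonneg (ψ s))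
  rwa [← pow_mul] at this

theorem integrable_quadraticDiff (φ ψ : X) : Integrable fun s => (φ s ^ 2 - ψ s ^ 2) ^ 2 := by
  have h4 (χ : X) : Integrable fun s => χ s ^ 4 := by
    simpa using integrable_quartic le_rfl χ
  refine ((h4 φ).add (h4 ψ)).mono' ?_ (ae_of_all _ fun s => ?_)
  · exact (((aestronglyMeasurable_X φ).pow 2).sub ((aestronglyMeasurable_X ψ).pow 2)).pow 2
  · rw [Real.norm_eq_abs, abs_of_nonneg (sq_nonneg _), Pi.add_apply]
    nlinarith [mul_nonneg (sq_nonneg (φ s)) (sq_nonneg (ψ s))]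

/-- Strong convexity of the energy as a function of the density. -/
theorem exists_energy_le_mean {C lam M : ℝ} (hC : 0 < C) (hl : 0 ≤ lam) {φ ψ : X}
    (hφ : ∀ᵐ s : ℝ, φ s ^ 2 ≤ M) (hψ : ∀ᵐ s : ℝ, ψ s ^ 2 ≤ M) :
    ∃ χ : X, (∀ᵐ s : ℝ, χ s = √((φ s ^ 2 + ψ s ^ 2) / 2)) ∧
      charge χ = (charge φ + charge ψ) / 2 ∧
      energy C lam χ ≤ (energy C lam φ + energy C lam ψ) / 2 -
        C * lam / (8 * √(1 + 2 * lam * M)) * ∫ s, (φ s ^ 2 - ψ s ^ 2) ^ 2 := by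
  obtain ⟨χ, hχ, hn⟩ := exists_quadraticMean φ ψ
  have hsq : ∀ᵐ s : ℝ, χ s ^ 2 = (φ s ^ 2 + ψ s ^ 2) / 2 := by
    filter_upwards [hχ] with s hs
    rw [hs, Real.sq_sqrt (by positivity)]
  refine ⟨χ, hχ, ?_, ?_⟩
  · unfold charge
    rw [← integral_add (integrable_sq_X φ) (integrable_sq_X ψ), ← integral_div]
    exact integral_congr_ae hsq
  have h1 : nonlinEnergy lam χ ≤ (nonlinEnergy lam φ + nonlinEnergy lam ψ) / 2 -
      lam / (8 * √(1 + 2 * lam * M)) * ∫ s, (φ s ^ 2 - ψ s ^ 2) ^ 2 := by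
    have i1 := ((integrable_nonlinEnergy hl φ).add (integrable_nonlinEnergy hl ψ)).div_const 2
    have i2 := (integrable_quadraticDiff φ ψ).const_mul (lam / (8 * √(1 + 2 * lam * M)))
    simp only [Pi.add_apply] at i1
    unfold nonlinEnergy
    rw [← integral_add (integrable_nonlinEnergy hl φ) (integrable_nonlinEnergy hl ψ),
      ← integral_div, ← integral_const_mul, ← integral_sub i1 i2]
    refine integral_mono_ae (integrable_nonlinEnergy hl χ) (i1.sub i2) ?_
    filter_upwards [hsq, hφ, hψ] with s h1 h2 h3
    simp only [h1]
    exact sqrt_mul_midpoint_le hl (sq_nonneg _) (sq_nonneg _) h2 h3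
  rw [energy_eq, energy_eq, energy_eq]
  have h2 := mul_le_mul_of_nonneg_left h1 hC.le
  have h3 : C * lam / (8 * √(1 + 2 * lam * M)) = C * (lam / (8 * √(1 + 2 * lam * M))) :=
    mul_div_assoc _ _ _
  rw [h3, mul_assoc]
  linarith

/-- The quadratic mean has charge one, so its energy is at least `m`. As `m` is only a lower bound,
neither function has to be a minimizer. -/
theorem integral_quadraticDiff_le {C lam M m : ℝ} (hC : 0 < C) (hl : 0 < lam) {φ ψ : X}
    (hφ : ∀ᵐ s : ℝ, φ s ^ 2 ≤ M) (hψ : ∀ᵐ s : ℝ, ψ s ^ 2 ≤ M) (hφ1 : charge φ = 1)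
    (hψ1 : charge ψ = 1) (hm : ∀ χ : X, charge χ = 1 → m ≤ energy C lam χ) :
    ∫ s, (φ s ^ 2 - ψ s ^ 2) ^ 2 ≤ 8 * √(1 + 2 * lam * M) / (C * lam) *
      ((energy C lam φ + energy C lam ψ) / 2 - m) := by
  obtain ⟨s, hs⟩ := hφ.exists
  have hM : 0 ≤ M := (sq_nonneg _).trans hs
  have hW := one_le_sqrt_one_add hl.le hM
  obtain ⟨χ, -, hχ1, hχ⟩ := exists_energy_le_mean hC hl.le hφ hψ
  have h1 := hm χ (by rw [hχ1, hφ1, hψ1]; norm_num)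
  have hk : 0 < C * lam / (8 * √(1 + 2 * lam * M)) := by positivity
  have h2 : C * lam / (8 * √(1 + 2 * lam * M)) * ∫ s, (φ s ^ 2 - ψ s ^ 2) ^ 2 ≤
      (energy C lam φ + energy C lam ψ) / 2 - m := by linarith
  rw [← inv_div (C * lam), ← div_eq_inv_mul, le_div_iff₀' hk]
  exact h2

/-- The quadratic mean of `ψ` with itself is `|ψ|`. -/
theorem exists_nonneg_energy_le {C lam : ℝ} (hC : 0 < C) (hl : 0 ≤ lam) (ψ : X) :
    ∃ χ : X, (∀ᵐ s : ℝ, 0 ≤ χ s) ∧ charge χ = charge ψ ∧ energy C lam χ ≤ energy C lam ψ := by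
  obtain ⟨M, -, hM⟩ := exists_sq_bound ψ
  obtain ⟨χ, hχ, hχ1, hχE⟩ := exists_energy_le_mean hC hl hM hM
  refine ⟨χ, ?_, by linarith, ?_⟩
  · filter_upwards [hχ] with s hs
    rw [hs]
    positivity
  · simpa using hχE

theorem ae_eq_of_integral_quadraticDiff {φ ψ : X} (hφ : ∀ᵐ s : ℝ, 0 ≤ φ s)
    (hψ : ∀ᵐ s : ℝ, 0 ≤ ψ s) (h : ∫ s, (φ s ^ 2 - ψ s ^ 2) ^ 2 ≤ 0) : φ = ψ := by
  have h0 : ∫ s, (φ s ^ 2 - ψ s ^ 2) ^ 2 = 0 :=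
    le_antisymm h (integral_nonneg fun s => sq_nonneg _)
  have h1 := (integral_eq_zero_iff_of_nonneg (fun s => sq_nonneg _)
    (integrable_quadraticDiff φ ψ)).1 h0
  refine ext_X ?_
  filter_upwards [h1, hφ, hψ] with s h1 h2 h3
  have h4 : φ s ^ 2 - ψ s ^ 2 = 0 := pow_eq_zero_iff two_ne_zero |>.1 h1
  exact (pow_left_inj₀ h2 h3 two_ne_zero).1 (by linarith)

/-! ### Interpolation estimates for the charge. -/

/-- The line is split at `|s| = R`: inside, the hypothesis is integrated; outside, `d² ≤ s² d²/R²`.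
-/
theorem charge_le_of_sq_le_add (d : X) {R ε : ℝ} (hR : 0 < R) {G : ℝ → ℝ} (hG : Integrable G)
    (hG0 : ∀ s, 0 ≤ G s) (h : ∀ s, d s ^ 2 ≤ ε + G s) :
    charge d ≤ 2 * R * ε + (∫ s, G s) + ‖d‖ ^ 2 / R ^ 2 := by
  have hi : Integrable ((Icc (-R) R).indicator fun _ : ℝ => ε) :=
    (integrable_indicator_iff measurableSet_Icc).2 (integrableOn_const (by simp))
  have hI : ∫ s, (Icc (-R) R).indicator (fun _ : ℝ => ε) s = 2 * R * ε := by
    rw [integral_indicator measurableSet_Icc, setIntegral_const, smul_eq_mul]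
    simp only [measureReal_def, Real.volume_Icc]
    rw [ENNReal.toReal_ofReal (by linarith)]
    ring
  have hw : ∫ s, s ^ 2 * d s ^ 2 ≤ ‖d‖ ^ 2 := by
    rw [norm_sq_X_eq_integral]
    have : 0 ≤ ∫ s, wderiv d s ^ 2 := integral_nonneg fun s => sq_nonneg _
    linarith
  have i2 := (integrable_weight_sq d).div_const (R ^ 2)
  calc charge d ≤ ∫ s, ((Icc (-R) R).indicator (fun _ : ℝ => ε) s + G s +
        s ^ 2 * d s ^ 2 / R ^ 2) := by
        refine integral_mono (integrable_sq_X d) ((hi.add hG).add i2) fun s => ?_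
        have h1 := hG0 s
        have h2 : 0 ≤ s ^ 2 * d s ^ 2 / R ^ 2 := by positivity
        by_cases hs : s ∈ Icc (-R) R
        · simp only [indicator_of_mem hs]
          linarith [h s]
        · simp only [indicator_of_notMem hs]
          have hsR : R ^ 2 ≤ s ^ 2 := by
            rw [mem_Icc, ← abs_le, not_le] at hs
            rw [← sq_abs s]
            exact pow_le_pow_left₀ hR.le hs.le 2
          have : d s ^ 2 ≤ s ^ 2 * d s ^ 2 / R ^ 2 := by
            rw [le_div_iff₀ (by positivity), mul_comm]
            exact mul_le_mul_of_nonneg_right hsR (sq_nonneg _)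
          linarith
    _ = 2 * R * ε + (∫ s, G s) + (∫ s, s ^ 2 * d s ^ 2) / R ^ 2 := by
        have e1 := integral_add (hi.add hG) i2
        simp only [Pi.add_apply] at e1
        rw [e1, integral_add hi hG, hI, integral_div]
    _ ≤ _ := by gcongr

/-- Interpolation between a fourth moment and the norm of `X`. -/
theorem charge_le_interpolation (d : X) {R ε : ℝ} (hR : 0 < R) (hε : 0 < ε) :
    charge d ≤ 2 * R * ε + (∫ s, d s ^ 4) / ε + ‖d‖ ^ 2 / R ^ 2 := by
  have h4 : Integrable fun s => d s ^ 4 := by simpa using integrable_quartic le_rfl d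
  rw [← integral_div]
  refine charge_le_of_sq_le_add d hR (h4.div_const ε) (fun s => by positivity) fun s => ?_
  -- The pointwise bound is `d² ≤ ε + d⁴/ε`.
  rw [← sub_le_iff_le_add', le_div_iff₀ hε]
  nlinarith [sq_nonneg (d s ^ 2 - ε), sq_nonneg (d s ^ 2), mul_pos hε hε,
    mul_nonneg hε.le (sq_nonneg (d s))]

/-- A lower bound on the interaction of a function of charge one that is independent of the
function. -/
theorem charge_le_nonlinEnergy_div {lam : ℝ} (hl : 0 ≤ lam) (ψ : X) {R ε : ℝ} (hR : 0 < R)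
    (hε : 0 < ε) :
    charge ψ ≤ 2 * R * ε + nonlinEnergy lam ψ / √(1 + 2 * lam * ε) + ‖ψ‖ ^ 2 / R ^ 2 := by
  unfold nonlinEnergy
  rw [← integral_div]
  refine charge_le_of_sq_le_add ψ hR ((integrable_nonlinEnergy hl ψ).div_const _)
    (fun s => by positivity) fun s => ?_
  have h1 := one_le_sqrt_one_add hl hε.le
  -- Where the density exceeds `ε`, the interaction weight is at least `√(1 + 2λε)`.
  rcases le_total (ψ s ^ 2) ε with h | h
  · have : 0 ≤ √(1 + 2 * lam * ψ s ^ 2) * ψ s ^ 2 / √(1 + 2 * lam * ε) := by positivity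
    linarith
  · have : ψ s ^ 2 ≤ √(1 + 2 * lam * ψ s ^ 2) * ψ s ^ 2 / √(1 + 2 * lam * ε) := by
      rw [le_div_iff₀ (by linarith), mul_comm]
      exact mul_le_mul_of_nonneg_right (Real.sqrt_le_sqrt (by nlinarith)) (sq_nonneg _)
    linarith

/-- For nonnegative numbers `|a - b| ≤ a + b`. This passes from densities back to functions. -/
theorem integral_pow_four_sub_le {φ ψ : X} (hφ : ∀ᵐ s : ℝ, 0 ≤ φ s) (hψ : ∀ᵐ s : ℝ, 0 ≤ ψ s) :
    ∫ s, (φ - ψ) s ^ 4 ≤ ∫ s, (φ s ^ 2 - ψ s ^ 2) ^ 2 := by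
  refine integral_mono_ae (by simpa using integrable_quartic le_rfl (φ - ψ))
    (integrable_quadraticDiff φ ψ) ?_
  have hs : ∀ᵐ s : ℝ, (φ - ψ) s = φ s - ψ s := by
    rw [map_sub]
    exact Lp.coeFn_sub (toL2 φ) (toL2 ψ)
  filter_upwards [hs, hφ, hψ] with s h1 h2 h3
  rw [h1]
  have h4 : (φ s - ψ s) ^ 4 = (φ s - ψ s) ^ 2 * (φ s - ψ s) ^ 2 := by ring
  have h5 : (φ s ^ 2 - ψ s ^ 2) ^ 2 = (φ s - ψ s) ^ 2 * (φ s + ψ s) ^ 2 := by ring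
  rw [h4, h5]
  refine mul_le_mul_of_nonneg_left ?_ (sq_nonneg _)
  nlinarith [mul_nonneg h2 h3]

/-! ### Existence and uniqueness of the ground state. -/

theorem memLp_nonlin_mul {lam : ℝ} (hl : 0 ≤ lam) (φ : X) :
    MemLp (fun s => nonlin lam (φ s) * φ s) 2 (volume : Measure ℝ) := by
  obtain ⟨M, -, hM⟩ := exists_sq_bound φ
  refine MemLp.of_le_mul (c := 1 + 3 * lam * M) (Lp.memLp (toL2 φ))
    (((continuous_nonlin hl).comp_aestronglyMeasurable (aestronglyMeasurable_X φ)).mul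
      (aestronglyMeasurable_X φ)) ?_
  filter_upwards [hM] with s hs
  rw [norm_mul]
  refine mul_le_mul_of_nonneg_right ?_ (norm_nonneg _)
  rw [Real.norm_eq_abs, abs_of_nonneg (nonlin_nonneg hl _)]
  exact nonlin_le hl hs

/-- Convexity of the interaction term. -/
theorem nonlinEnergy_ge_tangent {lam : ℝ} (hl : 0 ≤ lam) (φ ψ : X) :
    nonlinEnergy lam φ + 2 * inner ℝ (memLp_nonlin_mul hl φ).toLp (toL2 ψ - toL2 φ) ≤
      nonlinEnergy lam ψ := by
  set k := (memLp_nonlin_mul hl φ).toLp with hk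
  have hin : inner ℝ k (toL2 ψ - toL2 φ) = ∫ s, k s * (ψ s - φ s) := by
    rw [L2.inner_def]
    refine integral_congr_ae ?_
    filter_upwards [Lp.coeFn_sub (toL2 ψ) (toL2 φ)] with s hs
    rw [hs]
    simp [mul_comm]
  have hi : Integrable fun s => k s * (ψ s - φ s) :=
    (Lp.memLp k).integrable_mul ((Lp.memLp (toL2 ψ)).sub (Lp.memLp (toL2 φ)))
  unfold nonlinEnergy
  rw [hin, ← integral_const_mul,
    ← integral_add (integrable_nonlinEnergy hl φ) (hi.const_mul 2)]
  refine integral_mono_ae ((integrable_nonlinEnergy hl φ).add (hi.const_mul 2))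
    (integrable_nonlinEnergy hl ψ) ?_
  filter_upwards [(memLp_nonlin_mul hl φ).coeFn_toLp] with s hs
  have h1 := tangent_le_sqrt_mul hl (sq_nonneg (ψ s)) (sq_nonneg (φ s))
  have h2 : 0 ≤ lam * (ψ s ^ 2 - φ s ^ 2) ^ 2 /
      (√(1 + 2 * lam * ψ s ^ 2) + √(1 + 2 * lam * φ s ^ 2)) := by positivity
  -- `ψ² - φ² = 2φ(ψ - φ) + (ψ - φ)²`; the second summand has a nonnegative coefficient and is
  -- dropped.
  have h3 : 0 ≤ nonlin lam (φ s) * (ψ s - φ s) ^ 2 :=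
    mul_nonneg (nonlin_nonneg hl _) (sq_nonneg _)
  have h4 : (1 + 3 * lam * φ s ^ 2) / √(1 + 2 * lam * φ s ^ 2) = nonlin lam (φ s) := rfl
  rw [h4] at h1
  rw [← hk] at hs
  simp only [hs]
  linarith

theorem bddBelow_energy {C : ℝ} (hC : 0 < C) (lam : ℝ) :
    BddBelow (energy C lam '' {ψ | charge ψ = 1}) := by
  refine ⟨0, ?_⟩
  rintro _ ⟨ψ, -, rfl⟩
  exact (sq_nonneg _).trans (norm_sq_le_energy hC lam ψ)

/-- A sequence of nonnegative functions that minimizes the energy sufficiently fast converges in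
`L²`. -/
theorem cauchySeq_toL2_of_energy_le {C lam m : ℝ} (hC : 0 < C) (hl : 0 < lam)
    (hm : ∀ χ : X, charge χ = 1 → m ≤ energy C lam χ) {ψ : ℕ → X}
    (h0 : ∀ n, ∀ᵐ s : ℝ, 0 ≤ ψ n s) (h1 : ∀ n, charge (ψ n) = 1)
    (hE : ∀ n : ℕ, energy C lam (ψ n) ≤ m + (1 / ((n : ℝ) + 1)) ^ 4) :
    CauchySeq fun n => toL2 (ψ n) := by
  set M : ℝ := 2 + 2 * (m + 1) with hMdef
  have ht1 (n : ℕ) : 1 / ((n : ℝ) + 1) ≤ 1 := by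
    rw [div_le_one (by positivity)]
    linarith [(Nat.cast_nonneg n : (0 : ℝ) ≤ n)]
  have hn (n : ℕ) : ‖ψ n‖ ^ 2 ≤ m + 1 := by
    refine (norm_sq_le_energy hC lam _).trans ((hE n).trans ?_)
    have : (1 / ((n : ℝ) + 1)) ^ 4 ≤ 1 := pow_le_one₀ (by positivity) (ht1 n)
    linarith
  have hM (n : ℕ) : ∀ᵐ s : ℝ, ψ n s ^ 2 ≤ M := by
    filter_upwards [ae_sq_le (ψ n)] with s hs
    rw [h1] at hs
    linarith [hn n]
  set K : ℝ := 8 * √(1 + 2 * lam * M) / (C * lam) with hK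
  have hK0 : 0 ≤ K := by positivity
  set b : ℕ → ℝ := fun n => √(2 * (1 / ((n : ℝ) + 1)) ^ 2 + K * (1 / ((n : ℝ) + 1)) +
    4 * (m + 1) * (1 / ((n : ℝ) + 1)) ^ 2) with hb
  have hb0 : Tendsto b atTop (𝓝 0) := by
    have ht : Tendsto (fun n : ℕ => 1 / ((n : ℝ) + 1)) atTop (𝓝 0) :=
      tendsto_one_div_add_atTop_nhds_zero_nat
    have := ((((ht.pow 2).const_mul 2).add (ht.const_mul K)).add
      ((ht.pow 2).const_mul (4 * (m + 1)))).sqrt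
    have hz : √(2 * (0 : ℝ) ^ 2 + K * 0 + 4 * (m + 1) * 0 ^ 2) = 0 := by simp
    rwa [hz] at this
  refine cauchySeq_of_le_tendsto_0 b (fun n p N hnN hpN => ?_) hb0
  have hanti {k : ℕ} (hk : N ≤ k) : (1 / ((k : ℝ) + 1)) ^ 4 ≤ (1 / ((N : ℝ) + 1)) ^ 4 := by
    have : (N : ℝ) ≤ k := by exact_mod_cast hk
    gcongr
  set t : ℝ := 1 / ((N : ℝ) + 1) with ht
  have ht0 : 0 < t := by positivity
  have hEn := (hE n).trans (add_le_add_right (hanti hnN) m)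
  have hEp := (hE p).trans (add_le_add_right (hanti hpN) m)
  have h4 : ∫ s, (ψ n - ψ p) s ^ 4 ≤ K * t ^ 4 := by
    refine (integral_pow_four_sub_le (h0 n) (h0 p)).trans
      ((integral_quadraticDiff_le hC hl (hM n) (hM p) (h1 n) (h1 p) hm).trans ?_)
    exact mul_le_mul_of_nonneg_left (by linarith) hK0
  have hd : ‖ψ n - ψ p‖ ^ 2 ≤ 4 * (m + 1) := by
    have := parallelogram_law_with_norm ℝ (ψ n) (ψ p)
    nlinarith [hn n, hn p, mul_self_nonneg ‖ψ n + ψ p‖]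
  -- With a fourth moment of order `t⁴`, the choice `R = 1/t`, `ε = t³` makes all three terms
  -- `O(t)`.
  have hc := charge_le_interpolation (ψ n - ψ p) (R := t⁻¹) (ε := t ^ 3) (by positivity)
    (by positivity)
  have hc2 : charge (ψ n - ψ p) ≤ 2 * t ^ 2 + K * t + 4 * (m + 1) * t ^ 2 := by
    refine hc.trans ?_
    have e1 : 2 * t⁻¹ * t ^ 3 = 2 * t ^ 2 := by field_simp
    have e2 : (∫ s, (ψ n - ψ p) s ^ 4) / t ^ 3 ≤ K * t := by
      rw [div_le_iff₀ (by positivity)]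
      calc _ ≤ K * t ^ 4 := h4
        _ = _ := by ring
    have e3 : ‖ψ n - ψ p‖ ^ 2 / t⁻¹ ^ 2 ≤ 4 * (m + 1) * t ^ 2 := by
      rw [inv_pow, div_inv_eq_mul]
      exact mul_le_mul_of_nonneg_right hd (sq_nonneg t)
    linarith
  rw [charge_eq_norm_sq, map_sub] at hc2
  rw [dist_eq_norm]
  exact Real.le_sqrt_of_sq_le hc2

theorem exists_isGroundState_of_pos {C lam : ℝ} (hC : 0 < C) (hl : 0 < lam) :
    ∃ φ : X, IsGroundState C lam φ := by
  set m := sInf (energy C lam '' {ψ | charge ψ = 1}) with hmdef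
  have hm : ∀ χ : X, charge χ = 1 → m ≤ energy C lam χ := fun χ hχ =>
    csInf_le (bddBelow_energy hC lam) (mem_image_of_mem _ hχ)
  have hne : (energy C lam '' {ψ | charge ψ = 1}).Nonempty := by
    obtain ⟨ψ, hψ, -⟩ := exists_harmonic_groundState
    exact ⟨_, mem_image_of_mem _ hψ⟩
  have hex (n : ℕ) : ∃ ψ : X, (∀ᵐ s : ℝ, 0 ≤ ψ s) ∧ charge ψ = 1 ∧
      energy C lam ψ ≤ m + (1 / ((n : ℝ) + 1)) ^ 4 := by
    obtain ⟨_, ⟨ψ, hψ, rfl⟩, hlt⟩ := exists_lt_of_csInf_lt hne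
      (show m < m + (1 / ((n : ℝ) + 1)) ^ 4 from lt_add_of_pos_right _ (by positivity))
    obtain ⟨χ, h0, h1, h2⟩ := exists_nonneg_energy_le hC hl.le ψ
    exact ⟨χ, h0, h1.trans hψ, h2.trans hlt.le⟩
  choose ψ h0 h1 hE using hex
  obtain ⟨f, hf⟩ := cauchySeq_tendsto_of_complete
    (cauchySeq_toL2_of_energy_le hC hl hm h0 h1 hE)
  have ht : Tendsto (fun n : ℕ => m + (1 / ((n : ℝ) + 1)) ^ 4) atTop (𝓝 m) := by
    simpa using (tendsto_one_div_add_atTop_nhds_zero_nat (𝕜 := ℝ)).pow 4 |>.const_add m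
  obtain ⟨χ, hχ, -⟩ := exists_of_tendsto_toL2 hf
    (fun n => (norm_sq_le_energy hC lam (ψ n)).trans (hE n)) ht
  set k := (memLp_nonlin_mul hl.le χ).toLp
  have hk : Tendsto (fun n => inner ℝ k (toL2 (ψ n) - toL2 χ)) atTop (𝓝 0) := by
    have := (tendsto_const_nhds (x := k)).inner (𝕜 := ℝ) (hf.sub_const (toL2 χ))
    rwa [← hχ, sub_self, inner_zero_right] at this
  -- Semicontinuity is used a second time, now that the tangent functional at `χ` is available.
  -- Subtracting it from the energy bound gives `‖χ‖² ≤ m - C · nonlinEnergy lam χ` in the limit.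
  obtain ⟨χ', hχ', hle⟩ := exists_of_tendsto_toL2 hf
    (r := fun n => m + (1 / ((n : ℝ) + 1)) ^ 4 -
      C * (nonlinEnergy lam χ + 2 * inner ℝ k (toL2 (ψ n) - toL2 χ)))
    (R := m - C * (nonlinEnergy lam χ + 2 * 0)) (fun n => by
      have e1 := hE n
      rw [energy_eq] at e1
      have e2 := mul_le_mul_of_nonneg_left (nonlinEnergy_ge_tangent hl.le χ (ψ n)) hC.le
      linarith) (ht.sub (((hk.const_mul 2).const_add _).const_mul C))
  obtain rfl : χ' = χ := toL2_injective (hχ'.trans hχ.symm)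
  have hEχ : energy C lam χ' ≤ m := by
    rw [energy_eq]
    linarith
  have hc : charge χ' = 1 := by
    rw [charge_eq_norm_sq, hχ]
    refine tendsto_nhds_unique (hf.norm.pow 2) (tendsto_const_nhds.congr fun n => ?_)
    rw [← charge_eq_norm_sq, h1]
  obtain ⟨φ, hφ0, hφ1, hφE⟩ := exists_nonneg_energy_le hC hl.le χ'
  exact ⟨φ, hφ1.trans hc, fun η hη => (hφE.trans hEχ).trans (hm η hη), hφ0⟩

theorem energy_zero (C : ℝ) (ψ : X) : energy C 0 ψ = ‖ψ‖ ^ 2 + C * charge ψ := by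
  rw [energy_eq, nonlinEnergy_zero]

/-- Here the interaction is just `C` times the charge, so the minimizers are the equality cases of
`charge_le_norm_sq`; sign and charge fix the Gaussian's factor. -/
theorem existsUnique_isGroundState_zero (C : ℝ) : ∃! φ : X, IsGroundState C 0 φ := by
  obtain ⟨ψ, hψ, hψn, hψ0⟩ := exists_harmonic_groundState
  have hn {φ : X} (h : IsGroundState C 0 φ) : ‖φ‖ ^ 2 = charge φ := by
    have h1 := h.2.1 ψ hψ
    rw [energy_zero, energy_zero, h.1, hψ, hψn] at h1
    exact le_antisymm (by rw [h.1]; linarith) (charge_le_norm_sq φ)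
  have hg : IsGroundState C 0 ψ := by
    refine ⟨hψ, fun χ hχ => ?_, hψ0⟩
    rw [energy_zero, energy_zero, hψ, hχ, hψn]
    have := charge_le_norm_sq χ
    linarith
  have key {φ : X} (h : IsGroundState C 0 φ) : ∃ c : ℝ, 0 ≤ c ∧
      (∀ᵐ s : ℝ, φ s = c * Real.exp (-1 / 2 * s ^ 2)) ∧
      c ^ 2 * ∫ s : ℝ, Real.exp (-1 / 2 * s ^ 2) ^ 2 = 1 := by
    obtain ⟨c, hc⟩ := exists_eq_gaussian_of_norm_sq_eq (hn h)
    refine ⟨c, ?_, hc, ?_⟩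
    · obtain ⟨s, hs1, hs2⟩ := (hc.and h.2.2).exists
      rw [hs1] at hs2
      exact nonneg_of_mul_nonneg_left hs2 (Real.exp_pos _)
    · rw [← integral_const_mul]
      refine Eq.trans (integral_congr_ae ?_) h.1
      filter_upwards [hc] with s hs
      rw [hs, mul_pow]
  refine ⟨ψ, hg, fun φ hφ => ext_X ?_⟩
  obtain ⟨c, hc0, hc, hc1⟩ := key hφ
  obtain ⟨c', hc0', hc', hc1'⟩ := key hg
  have hI : (∫ s : ℝ, Real.exp (-1 / 2 * s ^ 2) ^ 2) ≠ 0 := by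
    intro h
    rw [h, mul_zero] at hc1
    exact zero_ne_one hc1
  have : c = c' := (pow_left_inj₀ hc0 hc0' two_ne_zero).1 (mul_right_cancel₀ hI (hc1.trans hc1'.symm))
  filter_upwards [hc, hc'] with s h1 h2
  rw [h1, h2, this]

theorem existsUnique_isGroundState {C lam : ℝ} (hC : 0 < C) (hl : 0 ≤ lam) :
    ∃! φ : X, IsGroundState C lam φ := by
  rcases hl.eq_or_lt with rfl | hl
  · exact existsUnique_isGroundState_zero C
  obtain ⟨φ, hφ⟩ := exists_isGroundState_of_pos hC hl
  refine ⟨φ, hφ, fun ψ hψ => ?_⟩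
  obtain ⟨M, -, hM⟩ := exists_sq_bound φ
  obtain ⟨M', -, hM'⟩ := exists_sq_bound ψ
  refine ae_eq_of_integral_quadraticDiff hψ.2.2 hφ.2.2 ?_
  refine (integral_quadraticDiff_le (M := max M M') hC hl
    (hM'.mono fun s hs => hs.trans (le_max_right _ _))
    (hM.mono fun s hs => hs.trans (le_max_left _ _)) hψ.1 hφ.1 hφ.2.1).trans_eq ?_
  have : energy C lam ψ = energy C lam φ :=
    le_antisymm (hψ.2.1 φ hφ.1) (hφ.2.1 ψ hψ.1)
  rw [this]
  simp

theorem isGroundState_groundState {C lam : ℝ} (hC : 0 < C) (hl : 0 ≤ lam) :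
    IsGroundState C lam (groundState C lam) :=
  Classical.epsilon_spec (existsUnique_isGroundState hC hl).exists

/-! ### The Euler–Lagrange equation and the chemical potential. -/

theorem nonlinEnergy_smul_le {lam c : ℝ} (hl : 0 ≤ lam) (hc : c ^ 2 ≤ 1) (ψ : X) :
    nonlinEnergy lam (c • ψ) ≤ c ^ 2 * nonlinEnergy lam ψ := by
  unfold nonlinEnergy
  rw [← integral_const_mul]
  refine integral_mono_ae (integrable_nonlinEnergy hl _)
    ((integrable_nonlinEnergy hl ψ).const_mul _) ?_
  filter_upwards [coeFn_smul_X c ψ] with s hs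
  rw [hs, mul_pow, mul_left_comm]
  refine mul_le_mul_of_nonneg_left (mul_le_mul_of_nonneg_right (Real.sqrt_le_sqrt ?_)
    (sq_nonneg _)) (sq_nonneg c)
  nlinarith [mul_nonneg hl (sq_nonneg (ψ s)),
    mul_nonneg (mul_nonneg hl (sq_nonneg (ψ s))) (sub_nonneg.2 hc)]

/-- Scaling down to charge one multiplies the energy by at most `1/Q(ψ)`. The relaxed constraint `Q
≥ 1` admits straight-line variations. -/
theorem IsGroundState.energy_le_of_one_le_charge {C lam : ℝ} (hC : 0 < C) (hl : 0 ≤ lam) {φ ψ : X}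
    (hφ : IsGroundState C lam φ) (hψ : 1 ≤ charge ψ) : energy C lam φ ≤ energy C lam ψ := by
  set q := charge ψ with hq
  have hq0 : 0 < q := by linarith
  have hc : (√q)⁻¹ ^ 2 = q⁻¹ := by rw [inv_pow, Real.sq_sqrt hq0.le]
  have hq1 : q⁻¹ ≤ 1 := inv_le_one_of_one_le₀ hψ
  have h1 := hφ.2.1 ((√q)⁻¹ • ψ) (by rw [charge_smul, hc, ← hq, inv_mul_cancel₀ hq0.ne'])
  have h2 := nonlinEnergy_smul_le hl (hc.trans_le hq1) ψ
  rw [energy_eq C lam (_ • ψ), norm_smul, mul_pow, Real.norm_eq_abs, sq_abs] at h1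
  rw [hc] at h1 h2
  have h3 := mul_le_mul_of_nonneg_left h2 hC.le
  have h4 : energy C lam φ ≤ q⁻¹ * energy C lam ψ := by
    rw [energy_eq C lam ψ]
    linarith
  have h5 : 0 ≤ energy C lam ψ := (sq_nonneg _).trans (norm_sq_le_energy hC lam ψ)
  exact h4.trans (mul_le_of_le_one_left h5 hq1)

theorem inner_toL2 (φ ψ : X) : inner ℝ (toL2 φ) (toL2 ψ) = ∫ s, φ s * ψ s := by
  rw [L2.inner_def]
  exact integral_congr_ae (ae_of_all _ fun s => by simp [mul_comm])

/-- The interaction term along a line, to second order. -/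
theorem exists_nonlinEnergy_add_smul_le {lam : ℝ} (hl : 0 ≤ lam) (φ η : X) :
    ∃ K : ℝ, ∀ t : ℝ, |t| ≤ 1 → nonlinEnergy lam (φ + t • η) ≤ nonlinEnergy lam φ +
      2 * t * inner ℝ (memLp_nonlin_mul hl φ).toLp (toL2 η) + K * t ^ 2 := by
  obtain ⟨M, hM0, hM⟩ := exists_sq_bound φ
  obtain ⟨M', hM0', hM'⟩ := exists_sq_bound η
  set k := (memLp_nonlin_mul hl φ).toLp with hk
  set K := 1 + 3 * lam * M + lam * (8 * M + 2 * M') with hK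
  refine ⟨K * charge η, fun t ht => ?_⟩
  have ht2 : t ^ 2 ≤ 1 := by
    rw [← sq_abs]
    exact pow_le_one₀ (abs_nonneg t) ht
  have hin : inner ℝ k (toL2 η) = ∫ s, k s * η s := by
    rw [L2.inner_def]
    exact integral_congr_ae (ae_of_all _ fun s => by simp [mul_comm])
  have i1 : Integrable fun s => 2 * t * (k s * η s) :=
    (integrable_mul_L2R k (toL2 η)).const_mul _
  have i2 : Integrable fun s => K * t ^ 2 * η s ^ 2 := (integrable_sq_X η).const_mul _
  have i0 := integrable_nonlinEnergy hl φ
  have e : K * charge η * t ^ 2 = ∫ s, K * t ^ 2 * η s ^ 2 := by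
    rw [integral_const_mul]
    unfold charge
    ring
  rw [hin, e, ← integral_const_mul]
  unfold nonlinEnergy
  have e2 := integral_add (i0.add i1) i2
  rw [integral_add' i0 i1] at e2
  rw [← e2]
  refine integral_mono_ae (integrable_nonlinEnergy hl _) ((i0.add i1).add i2) ?_
  filter_upwards [hM, hM', (memLp_nonlin_mul hl φ).coeFn_toLp, coeFn_add_X φ (t • η),
    coeFn_smul_X t η] with s h1 h2 h3 h4 h5
  simp only [Pi.add_apply]
  rw [h4, h5]
  have h6 := sqrt_mul_le_quadratic (r := φ s) (δ := t * η s) hl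
  rw [← hk] at h3
  rw [h3]
  have h7 := nonlin_le hl h1
  have h8 : nonlin lam (φ s) * (t * η s) ^ 2 ≤ (1 + 3 * lam * M) * (t * η s) ^ 2 :=
    mul_le_mul_of_nonneg_right h7 (sq_nonneg _)
  have h9 : (2 * φ s * (t * η s) + (t * η s) ^ 2) ^ 2 ≤ (8 * M + 2 * M') * (t * η s) ^ 2 := by
    have a1 : (2 * φ s * (t * η s) + (t * η s) ^ 2) ^ 2 = (t * η s) ^ 2 * (2 * φ s + t * η s) ^ 2 := by
      ring
    have a2 : (2 * φ s + t * η s) ^ 2 ≤ 8 * φ s ^ 2 + 2 * (t * η s) ^ 2 := by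
      nlinarith [sq_nonneg (2 * φ s - t * η s)]
    have a3 : (t * η s) ^ 2 ≤ M' := by
      rw [mul_pow]
      nlinarith [sq_nonneg (η s), sq_nonneg t]
    rw [a1, mul_comm]
    exact mul_le_mul_of_nonneg_right (by linarith) (sq_nonneg _)
  have h10 := mul_le_mul_of_nonneg_left h9 hl
  have h11 : K * t ^ 2 * η s ^ 2 =
      (1 + 3 * lam * M) * (t * η s) ^ 2 + lam * ((8 * M + 2 * M') * (t * η s) ^ 2) := by
    rw [hK]
    ring
  rw [h11]
  linarith

theorem eq_zero_of_forall_quadratic_nonneg {a b : ℝ}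
    (h : ∀ t : ℝ, |t| ≤ 1 → 0 ≤ a * t + b * t ^ 2) : a = 0 := by
  have hd : HasDerivAt (fun t : ℝ => a * t + b * t ^ 2) a 0 := by
    have h1 := ((hasDerivAt_id (0 : ℝ)).const_mul a).add ((hasDerivAt_pow 2 (0 : ℝ)).const_mul b)
    exact h1.congr_deriv (by simp)
  have hmin : IsLocalMin (fun t : ℝ => a * t + b * t ^ 2) 0 := by
    filter_upwards [Metric.closedBall_mem_nhds (0 : ℝ) one_pos] with t ht
    simpa using h t (by simpa using ht)
  exact hmin.hasDerivAt_eq_zero hd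

/-- The Euler–Lagrange equation in the directions orthogonal to the ground state. -/
theorem IsGroundState.eulerLagrange {C lam : ℝ} (hC : 0 < C) (hl : 0 ≤ lam) {φ : X}
    (hφ : IsGroundState C lam φ) {η : X} (hη : inner ℝ (toL2 φ) (toL2 η) = 0) :
    inner ℝ φ η + C * inner ℝ (memLp_nonlin_mul hl φ).toLp (toL2 η) = 0 := by
  obtain ⟨K, hK⟩ := exists_nonlinEnergy_add_smul_le hl φ η
  have h := eq_zero_of_forall_quadratic_nonneg
    (a := 2 * (inner ℝ φ η + C * inner ℝ (memLp_nonlin_mul hl φ).toLp (toL2 η)))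
    (b := ‖η‖ ^ 2 + C * K) (fun t ht => by
      -- Orthogonality removes the term linear in `t`, so the charge never drops below one.
      have hc : charge (φ + t • η) = 1 + t ^ 2 * charge η := by
        rw [charge_eq_norm_sq, map_add, map_smul, norm_add_sq_real, inner_smul_right, hη,
          ← charge_eq_norm_sq, hφ.1, norm_smul, mul_pow, ← charge_eq_norm_sq, Real.norm_eq_abs,
          sq_abs]
        ring
      have h1 := hφ.energy_le_of_one_le_charge hC hl (ψ := φ + t • η)
        (by rw [hc]; nlinarith [charge_nonneg η, sq_nonneg t])
      have h2 := mul_le_mul_of_nonneg_left (hK t ht) hC.le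
      rw [energy_eq, energy_eq, norm_add_sq_real, inner_smul_right, norm_smul, mul_pow,
        Real.norm_eq_abs, sq_abs] at h1
      linarith)
  linarith

theorem isChemicalPotential_iff {C lam : ℝ} (hl : 0 ≤ lam) (φ : X) (μ : ℝ) :
    IsChemicalPotential C lam φ μ ↔ ∀ η : X,
      inner ℝ φ η + C * inner ℝ (memLp_nonlin_mul hl φ).toLp (toL2 η) =
        μ * inner ℝ (toL2 φ) (toL2 η) := by
  refine forall_congr' fun η => ?_
  have h1 : inner ℝ φ η = (∫ s, wderiv φ s * wderiv η s) + ∫ s, s ^ 2 * (φ s * η s) := by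
    rw [inner_def, integral_add (integrable_mul_L2R _ _)]
    refine (integrable_mul_L2R (mulVar φ) (mulVar η)).congr ?_
    filter_upwards [coeFn_mulVar φ, coeFn_mulVar η] with s h1 h2
    rw [h1, h2]
    ring
  have h2 : inner ℝ (memLp_nonlin_mul hl φ).toLp (toL2 η) = ∫ s, nonlin lam |φ s| * φ s * η s := by
    rw [L2.inner_def]
    refine integral_congr_ae ?_
    filter_upwards [(memLp_nonlin_mul hl φ).coeFn_toLp] with s hs
    rw [hs]
    simp [nonlin, mul_comm]
  rw [h1, h2, inner_toL2]

theorem nonlin_mul_sq_eq {lam r : ℝ} (hl : 0 ≤ lam) :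
    nonlin lam r * r ^ 2 =
      √(1 + 2 * lam * r ^ 2) * r ^ 2 + lam * (r ^ 4 / √(1 + 2 * lam * r ^ 2)) := by
  have hw := one_le_sqrt_one_add hl (sq_nonneg r)
  have hw2 := sq_sqrt_one_add hl (sq_nonneg r)
  unfold nonlin
  set w := √(1 + 2 * lam * r ^ 2)
  have hw0 : w ≠ 0 := by linarith
  field_simp
  rw [hw2]
  ring

theorem inner_nonlin_self {lam : ℝ} (hl : 0 ≤ lam) (φ : X) :
    inner ℝ (memLp_nonlin_mul hl φ).toLp (toL2 φ) = nonlinEnergy lam φ + lam * quartic lam φ := by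
  unfold nonlinEnergy quartic
  rw [← integral_const_mul, ← integral_add (integrable_nonlinEnergy hl φ)
    ((integrable_quartic hl φ).const_mul _), L2.inner_def]
  refine integral_congr_ae ?_
  filter_upwards [(memLp_nonlin_mul hl φ).coeFn_toLp] with s hs
  rw [hs, ← nonlin_mul_sq_eq hl]
  simp only [RCLike.inner_apply, conj_trivial]
  ring

/-- Testing with `φ` determines `μ`. Conversely, every `η` is a multiple of `φ` plus a direction
orthogonal to `φ` in `L²`, where `eulerLagrange` applies. -/
theorem IsGroundState.isChemicalPotential_iff {C lam : ℝ} (hC : 0 < C) (hl : 0 ≤ lam) {φ : X}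
    (hφ : IsGroundState C lam φ) (μ : ℝ) :
    IsChemicalPotential C lam φ μ ↔ μ = energy C lam φ + lam * (C * quartic lam φ) := by
  have hself : inner ℝ φ φ + C * inner ℝ (memLp_nonlin_mul hl φ).toLp (toL2 φ) =
      energy C lam φ + lam * (C * quartic lam φ) := by
    rw [inner_nonlin_self hl, energy_eq, real_inner_self_eq_norm_sq]
    ring
  have hφ1 : inner ℝ (toL2 φ) (toL2 φ) = (1 : ℝ) := by
    rw [real_inner_self_eq_norm_sq, ← charge_eq_norm_sq, hφ.1]
  rw [CigarBEC.isChemicalPotential_iff hl]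
  constructor
  · intro h
    rw [← hself, h φ, hφ1, mul_one]
  · rintro rfl η
    set a : ℝ := inner ℝ (toL2 φ) (toL2 η) with ha
    have h := hφ.eulerLagrange hC hl (η := η - a • φ) (by
      rw [map_sub, map_smul, inner_sub_right, inner_smul_right, hφ1, ← ha]
      ring)
    rw [map_sub, map_smul, inner_sub_right, inner_sub_right, inner_smul_right,
      inner_smul_right] at h
    rw [← hself]
    linarith

theorem existsUnique_isChemicalPotential {C lam : ℝ} (hC : 0 < C) (hl : 0 ≤ lam) :
    ∃! μ : ℝ, IsChemicalPotential C lam (groundState C lam) μ := by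
  have h := (isGroundState_groundState hC hl).isChemicalPotential_iff hC hl
  exact ⟨_, (h _).2 rfl, fun μ hμ => (h μ).1 hμ⟩

theorem muMin_eq {C lam : ℝ} (hC : 0 < C) (hl : 0 ≤ lam) :
    muMin C lam = Emin C lam + lam * (C * quartic lam (groundState C lam)) :=
  ((isGroundState_groundState hC hl).isChemicalPotential_iff hC hl _).1
    (Classical.epsilon_spec (existsUnique_isChemicalPotential hC hl).exists)

/-! ### Monotonicity, concavity and growth of the minimal energy. -/

theorem energy_le_tangent {C lam lam' : ℝ} (hC : 0 < C) (hl : 0 ≤ lam) (hl' : 0 ≤ lam') (ψ : X) :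
    energy C lam' ψ ≤ energy C lam ψ + (lam' - lam) * (C * quartic lam ψ) := by
  rw [energy_eq, energy_eq]
  have := mul_le_mul_of_nonneg_left (nonlinEnergy_le_tangent hl hl' ψ) hC.le
  linarith

theorem quartic_pos {lam : ℝ} (hl : 0 ≤ lam) {ψ : X} (hψ : charge ψ = 1) : 0 < quartic lam ψ := by
  refine (quartic_nonneg lam ψ).lt_of_ne fun h => ?_
  have h1 := (integral_eq_zero_iff_of_nonneg (fun s => by positivity)
    (integrable_quartic hl ψ)).1 h.symm
  have h2 : charge ψ = 0 := by
    refine integral_eq_zero_of_ae ?_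
    filter_upwards [h1] with s hs
    have hw := one_le_sqrt_one_add hl (sq_nonneg (ψ s))
    rcases div_eq_zero_iff.1 hs with h3 | h3
    · rw [pow_eq_zero_iff four_ne_zero] at h3
      simp [h3]
    · linarith
  rw [hψ] at h2
  exact one_ne_zero h2

/-- The slope `C ∫ φ_λ⁴ / √(1 + 2 λ φ_λ²) ds` of the minimal energy. -/
def slopeEmin (C lam : ℝ) : ℝ := C * quartic lam (groundState C lam)

theorem slopeEmin_pos {C lam : ℝ} (hC : 0 < C) (hl : 0 ≤ lam) : 0 < slopeEmin C lam :=
  mul_pos hC (quartic_pos hl (isGroundState_groundState hC hl).1)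

theorem Emin_le_energy {C lam : ℝ} (hC : 0 < C) (hl : 0 ≤ lam) {ψ : X} (hψ : charge ψ = 1) :
    Emin C lam ≤ energy C lam ψ :=
  (isGroundState_groundState hC hl).2.1 ψ hψ

theorem Emin_pos {C lam : ℝ} (hC : 0 < C) (hl : 0 ≤ lam) : 0 < Emin C lam := by
  have h1 := charge_le_nonlinEnergy hl (groundState C lam)
  rw [(isGroundState_groundState hC hl).1] at h1
  unfold Emin
  rw [energy_eq]
  have := mul_le_mul_of_nonneg_left h1 hC.le
  nlinarith [sq_nonneg ‖groundState C lam‖]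

/-- The slope is a supergradient of the minimal energy. -/
theorem Emin_le_tangent {C lam lam' : ℝ} (hC : 0 < C) (hl : 0 ≤ lam) (hl' : 0 ≤ lam') :
    Emin C lam' ≤ Emin C lam + (lam' - lam) * slopeEmin C lam :=
  (Emin_le_energy hC hl' (isGroundState_groundState hC hl).1).trans (energy_le_tangent hC hl hl' _)

theorem strictMonoOn_Emin {C : ℝ} (hC : 0 < C) : StrictMonoOn (Emin C) (Ici 0) := by
  intro a ha b hb hab
  have h1 := Emin_le_tangent hC (mem_Ici.1 hb) (mem_Ici.1 ha)
  have h2 := slopeEmin_pos hC (mem_Ici.1 hb)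
  nlinarith [mul_pos (sub_pos.2 hab) h2]

/-- The supergradient inequalities based at `a` and at `b` are added. -/
theorem antitoneOn_slopeEmin {C : ℝ} (hC : 0 < C) : AntitoneOn (slopeEmin C) (Ici 0) := by
  intro a ha b hb hab
  rcases hab.eq_or_lt with rfl | hab
  · exact le_rfl
  have h1 := Emin_le_tangent hC (mem_Ici.1 hb) (mem_Ici.1 ha)
  have h2 := Emin_le_tangent hC (mem_Ici.1 ha) (mem_Ici.1 hb)
  by_contra! h
  nlinarith [mul_pos (sub_pos.2 hab) (sub_pos.2 h)]

theorem concaveOn_Emin {C : ℝ} (hC : 0 < C) : ConcaveOn ℝ (Ici 0) (Emin C) := by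
  refine ⟨convex_Ici 0, fun x hx y hy a b ha hb hab => ?_⟩
  rw [mem_Ici] at hx hy
  simp only [smul_eq_mul]
  set z := a * x + b * y with hz
  have hz0 : 0 ≤ z := by positivity
  have h1 := mul_le_mul_of_nonneg_left (Emin_le_tangent hC hz0 hx) ha
  have h2 := mul_le_mul_of_nonneg_left (Emin_le_tangent hC hz0 hy) hb
  have h3 : a * (Emin C z + (x - z) * slopeEmin C z) + b * (Emin C z + (y - z) * slopeEmin C z) =
      Emin C z := by
    have hb' : b = 1 - a := by linarith
    rw [hz, hb']
    ring
  linarith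

theorem tendsto_Emin {C : ℝ} (hC : 0 < C) : Tendsto (Emin C) atTop atTop := by
  refine tendsto_atTop.2 fun b => ?_
  set B : ℝ := max b 1 with hB
  have hB1 : 1 ≤ B := le_max_right _ _
  -- If the energy stays below `B`, these choices of `R` and `ε` bound the charge by `1/4 + 1/4`
  -- plus a term below `1/2` for large `λ`, contradicting charge one.
  set R : ℝ := 2 * √B with hR
  have hR0 : 0 < R := by positivity
  have hR2 : R ^ 2 = 4 * B := by
    rw [hR, mul_pow, Real.sq_sqrt (by linarith)]
    norm_num
  set ε : ℝ := 1 / (8 * R) with hε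
  have hε0 : 0 < ε := by positivity
  have ht : Tendsto (fun lam : ℝ => √(1 + 2 * lam * ε)) atTop atTop := by
    refine Real.tendsto_sqrt_atTop.comp (tendsto_atTop_add_const_left _ _ ?_)
    exact (tendsto_id.const_mul_atTop two_pos).atTop_mul_const hε0
  filter_upwards [eventually_ge_atTop 0, ht.eventually_gt_atTop (2 * (B / C))] with lam hl hlarge
  by_contra! hlt
  have hEB : Emin C lam < B := hlt.trans_le (le_max_left _ _)
  have hg := isGroundState_groundState hC hl
  have h1 := charge_le_nonlinEnergy_div hl (groundState C lam) hR0 hε0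
  have h2 : energy C lam (groundState C lam) < B := hEB
  have h3 := (norm_sq_le_energy hC lam (groundState C lam)).trans h2.le
  have hw : 0 < √(1 + 2 * lam * ε) := by
    have := one_le_sqrt_one_add hl hε0.le
    linarith
  have h4 : nonlinEnergy lam (groundState C lam) ≤ B / C := by
    rw [le_div_iff₀ hC]
    rw [energy_eq] at h2
    nlinarith [sq_nonneg ‖groundState C lam‖]
  have h5 : nonlinEnergy lam (groundState C lam) / √(1 + 2 * lam * ε) < 1 / 2 := by
    rw [div_lt_iff₀ hw]
    linarith
  have h6 : ‖groundState C lam‖ ^ 2 / R ^ 2 ≤ 1 / 4 := by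
    rw [hR2, div_le_iff₀ (by positivity)]
    linarith
  have h7 : 2 * R * ε = 1 / 4 := by
    rw [hε]
    field_simp
    norm_num
  rw [hg.1] at h1
  linarith

/-! ### Continuity of the slope and differentiability of the minimal energy. -/

/-- Young's inequality with a free parameter `t` separates the difference of the densities from
their sum. -/
theorem abs_quartic_sub_le {lam M t : ℝ} (hl : 0 ≤ lam) (ht : 0 < t) {φ ψ : X}
    (hφ : ∀ᵐ s : ℝ, φ s ^ 2 ≤ M) (hψ : ∀ᵐ s : ℝ, ψ s ^ 2 ≤ M) :
    |quartic lam φ - quartic lam ψ| ≤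
      (∫ s, (φ s ^ 2 - ψ s ^ 2) ^ 2) / (2 * t) + t * M * (charge φ + charge ψ) := by
  have i1 := (integrable_quadraticDiff φ ψ).div_const (2 * t)
  have i2 : Integrable fun s => t * M * (φ s ^ 2 + ψ s ^ 2) :=
    ((integrable_sq_X φ).add (integrable_sq_X ψ)).const_mul _
  have e : t * M * (charge φ + charge ψ) = ∫ s, t * M * (φ s ^ 2 + ψ s ^ 2) := by
    rw [integral_const_mul, integral_add (integrable_sq_X φ) (integrable_sq_X ψ)]
    rfl
  unfold quartic
  rw [e, ← integral_div, ← integral_add i1 i2,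
    ← integral_sub (integrable_quartic hl φ) (integrable_quartic hl ψ)]
  refine abs_integral_le_integral_abs.trans (integral_mono_ae
    ((integrable_quartic hl φ).sub (integrable_quartic hl ψ)).abs (i1.add i2) ?_)
  filter_upwards [hφ, hψ] with s h1 h2
  have h3 := abs_sq_div_sqrt_sub_le hl (sq_nonneg (φ s)) (sq_nonneg (ψ s))
  rw [← pow_mul, ← pow_mul] at h3
  refine h3.trans ?_
  have hx := sq_nonneg (φ s)
  have hy := sq_nonneg (ψ s)
  set x := φ s ^ 2
  set y := ψ s ^ 2
  have h4 : |x - y| * (x + y) ≤ (x - y) ^ 2 / (2 * t) + t / 2 * (x + y) ^ 2 := by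
    rw [← sub_le_iff_le_add, le_div_iff₀ (by positivity)]
    nlinarith [sq_nonneg (|x - y| - t * (x + y)), sq_abs (x - y)]
  have h5 : (x + y) ^ 2 ≤ 2 * M * (x + y) := by nlinarith
  nlinarith [mul_le_mul_of_nonneg_left h5 (by positivity : 0 ≤ t / 2)]

theorem abs_quartic_sub_le_param {lam lam' M : ℝ} (hl : 0 ≤ lam) (hl' : 0 ≤ lam') {ψ : X}
    (hψ : ∀ᵐ s : ℝ, ψ s ^ 2 ≤ M) :
    |quartic lam ψ - quartic lam' ψ| ≤ |lam - lam'| * M ^ 2 * charge ψ := by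
  unfold quartic charge
  rw [← integral_const_mul, ← integral_sub (integrable_quartic hl ψ) (integrable_quartic hl' ψ)]
  refine abs_integral_le_integral_abs.trans (integral_mono_ae
    ((integrable_quartic hl ψ).sub (integrable_quartic hl' ψ)).abs
    ((integrable_sq_X ψ).const_mul _) ?_)
  filter_upwards [hψ] with s h1
  have h3 := abs_sq_div_sqrt_sub_le_param hl hl' (sq_nonneg (ψ s))
  rw [← pow_mul] at h3
  refine h3.trans ?_
  have hx := sq_nonneg (ψ s)
  have h4 : (ψ s ^ 2) ^ 3 ≤ M ^ 2 * ψ s ^ 2 := by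
    rw [pow_succ]
    exact mul_le_mul_of_nonneg_right (pow_le_pow_left₀ hx h1 2) hx
  rw [mul_assoc]
  exact mul_le_mul_of_nonneg_left h4 (abs_nonneg _)

theorem groundState_sq_le {C lam lam' : ℝ} (hC : 0 < C) (hl : 0 ≤ lam) (h : lam ≤ lam') :
    ∀ᵐ s : ℝ, groundState C lam s ^ 2 ≤ 2 + 2 * Emin C lam' := by
  have h1 : Emin C lam ≤ Emin C lam' :=
    (strictMonoOn_Emin hC).monotoneOn (mem_Ici.2 hl) (mem_Ici.2 (hl.trans h)) h
  have h2 : ‖groundState C lam‖ ^ 2 ≤ Emin C lam := norm_sq_le_energy hC lam _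
  filter_upwards [ae_sq_le (groundState C lam)] with s hs
  rw [(isGroundState_groundState hC hl).1] at hs
  linarith

/-- Hölder continuity of the ground state density in `L²`. -/
theorem integral_groundState_diff_le {C lam₀ lam : ℝ} (hC : 0 < C) (hl₀ : 0 < lam₀) (hl : 0 ≤ lam)
    (h : lam ≤ 2 * lam₀) :
    ∫ s, (groundState C lam s ^ 2 - groundState C lam₀ s ^ 2) ^ 2 ≤
      8 * √(1 + 2 * lam₀ * (2 + 2 * Emin C (2 * lam₀))) / (C * lam₀) *
        (slopeEmin C 0 * |lam - lam₀|) := by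
  refine (integral_quadraticDiff_le hC hl₀ (groundState_sq_le hC hl h)
    (groundState_sq_le hC hl₀.le (by linarith)) (isGroundState_groundState hC hl).1
    (isGroundState_groundState hC hl₀.le).1 (fun χ hχ => Emin_le_energy hC hl₀.le hχ)).trans ?_
  refine mul_le_mul_of_nonneg_left ?_ (by positivity)
  have h1 := energy_le_tangent hC hl hl₀.le (groundState C lam)
  have h2 := Emin_le_tangent hC hl₀.le hl
  have h3 := slopeEmin_pos hC hl
  have h4 := slopeEmin_pos hC hl₀.le
  have h5 := antitoneOn_slopeEmin hC (mem_Ici.2 le_rfl) (mem_Ici.2 hl) hl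
  have h6 := antitoneOn_slopeEmin hC (mem_Ici.2 le_rfl) (mem_Ici.2 hl₀.le) hl₀.le
  -- The left side bounds the excess energy of `φ_λ` at the parameter `λ₀`, by the tangent
  -- inequalities in both directions; both slopes lie between `0` and the slope at `0`.
  have h7 : (lam - lam₀) * (slopeEmin C lam₀ - slopeEmin C lam) ≤
      slopeEmin C 0 * |lam - lam₀| := by
    rw [mul_comm (slopeEmin C 0)]
    refine (le_abs_self _).trans ?_
    rw [abs_mul]
    exact mul_le_mul_of_nonneg_left (abs_le.2 ⟨by linarith, by linarith⟩) (abs_nonneg _)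
  have h8 : energy C lam₀ (groundState C lam₀) = Emin C lam₀ := rfl
  have h9 : energy C lam (groundState C lam) = Emin C lam := rfl
  have h10 : C * quartic lam (groundState C lam) = slopeEmin C lam := rfl
  have h11 := Emin_le_energy hC hl₀.le (isGroundState_groundState hC hl).1
  rw [h9, h10] at h1
  rw [h8]
  linarith

theorem continuousAt_slopeEmin {C lam₀ : ℝ} (hC : 0 < C) (hl₀ : 0 < lam₀) :
    ContinuousAt (slopeEmin C) lam₀ := by
  refine ContinuousAt.mul continuousAt_const ?_
  set M : ℝ := 2 + 2 * Emin C (2 * lam₀) with hM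
  set K : ℝ := 8 * √(1 + 2 * lam₀ * M) / (C * lam₀) * slopeEmin C 0 with hK
  have hb : Tendsto (fun lam : ℝ => K * √|lam - lam₀| / 2 + √|lam - lam₀| * M * 2 +
      |lam - lam₀| * M ^ 2) (𝓝 lam₀) (𝓝 0) := by
    have hc : Continuous fun lam : ℝ => K * √|lam - lam₀| / 2 + √|lam - lam₀| * M * 2 +
      |lam - lam₀| * M ^ 2 := by fun_prop
    simpa using hc.tendsto lam₀
  rw [ContinuousAt, tendsto_iff_dist_tendsto_zero]
  refine squeeze_zero' (Eventually.of_forall fun _ => dist_nonneg) ?_ hb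
  filter_upwards [Ioo_mem_nhds hl₀ (show lam₀ < 2 * lam₀ by linarith)] with lam hlam
  rw [Real.dist_eq]
  rcases eq_or_ne lam lam₀ with rfl | hne
  · simp
  -- Since the density difference is `O(|λ - λ₀|)` in squared norm, this `t` makes both Young terms
  -- of order `√|λ - λ₀|`.
  set t := √|lam - lam₀| with ht
  have hpos : 0 < |lam - lam₀| := abs_pos.2 (sub_ne_zero.2 hne)
  have ht0 : 0 < t := Real.sqrt_pos.2 hpos
  have ht2 : t ^ 2 = |lam - lam₀| := Real.sq_sqrt hpos.le
  have h1 := integral_groundState_diff_le hC hl₀ hlam.1.le hlam.2.le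
  have b1 := groundState_sq_le hC hlam.1.le hlam.2.le
  have b0 := groundState_sq_le hC hl₀.le (show lam₀ ≤ 2 * lam₀ by linarith)
  have h2 := abs_quartic_sub_le hlam.1.le ht0 b1 b0
  have h3 := abs_quartic_sub_le_param hlam.1.le hl₀.le b0
  rw [(isGroundState_groundState hC hlam.1.le).1, (isGroundState_groundState hC hl₀.le).1] at h2
  rw [(isGroundState_groundState hC hl₀.le).1, mul_one] at h3
  have h4 : (∫ s, (groundState C lam s ^ 2 - groundState C lam₀ s ^ 2) ^ 2) / (2 * t) ≤
      K * t / 2 := by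
    rw [div_le_iff₀ (by positivity)]
    refine h1.trans_eq ?_
    rw [← ht2, hK]
    ring
  have h5 := abs_sub_le (quartic lam (groundState C lam)) (quartic lam (groundState C lam₀))
    (quartic lam₀ (groundState C lam₀))
  rw [← hM] at h2 h3
  norm_num at h2
  linarith

/-- The supergradients at `λ` and `λ₀` place the linearization error between `(λ - λ₀)(D(λ) -
D(λ₀))` and `0`, where `D` is `slopeEmin C`. -/
theorem hasDerivAt_Emin {C lam₀ : ℝ} (hC : 0 < C) (hl₀ : 0 < lam₀) :
    HasDerivAt (Emin C) (slopeEmin C lam₀) lam₀ := by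
  rw [hasDerivAt_iff_isLittleO, Asymptotics.isLittleO_iff]
  intro ε hε
  filter_upwards [Ioi_mem_nhds hl₀, Metric.continuousAt_iff'.1 (continuousAt_slopeEmin hC hl₀) ε hε]
    with lam hlam hd
  have h1 := Emin_le_tangent hC hl₀.le (le_of_lt hlam)
  have h2 := Emin_le_tangent hC (le_of_lt hlam) hl₀.le
  rw [Real.dist_eq] at hd
  simp only [Real.norm_eq_abs, smul_eq_mul]
  have h3 : |lam - lam₀| * |slopeEmin C lam - slopeEmin C lam₀| ≤ ε * |lam - lam₀| := by
    rw [mul_comm ε]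
    exact mul_le_mul_of_nonneg_left hd.le (abs_nonneg _)
  refine le_trans ?_ h3
  rw [← abs_mul, abs_of_nonpos (by linarith)]
  refine le_trans ?_ (neg_le_abs _)
  linarith

theorem contDiffOn_Emin {C : ℝ} (hC : 0 < C) : ContDiffOn ℝ 1 (Emin C) (Ioi 0) := by
  rw [show (1 : WithTop ℕ∞) = 0 + 1 by simp, contDiffOn_succ_iff_deriv_of_isOpen isOpen_Ioi]
  refine ⟨fun x hx => (hasDerivAt_Emin hC hx).differentiableAt.differentiableWithinAt, by simp, ?_⟩
  rw [contDiffOn_zero]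
  have h : ContinuousOn (slopeEmin C) (Ioi 0) :=
    fun x hx => (continuousAt_slopeEmin hC hx).continuousWithinAt
  exact h.congr fun x hx => (hasDerivAt_Emin hC hx).deriv

theorem continuousOn_Emin {C : ℝ} (hC : 0 < C) : ContinuousOn (Emin C) (Ici 0) := by
  intro x hx
  rcases (mem_Ici.1 hx).eq_or_lt with rfl | hx
  -- At the endpoint, `E_min` is squeezed between its value at `0` and its tangent there.
  · have h : Tendsto (fun lam : ℝ => Emin C 0 + (lam - 0) * slopeEmin C 0) (𝓝[Ici 0] 0)
        (𝓝 (Emin C 0)) := by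
      have hc : Continuous fun lam : ℝ => Emin C 0 + (lam - 0) * slopeEmin C 0 := by fun_prop
      simpa using (hc.tendsto 0).mono_left nhdsWithin_le_nhds
    refine tendsto_of_tendsto_of_tendsto_of_le_of_le' tendsto_const_nhds h ?_ ?_
    · filter_upwards [self_mem_nhdsWithin] with lam hlam
      exact (strictMonoOn_Emin hC).monotoneOn (mem_Ici.2 le_rfl) hlam hlam
    · filter_upwards [self_mem_nhdsWithin] with lam hlam
      exact Emin_le_tangent hC le_rfl hlam
  · exact (hasDerivAt_Emin hC hx).continuousAt.continuousWithinAt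

/-! ### Continuity, growth and averages of the chemical potential. -/

theorem muMin_eq_slope {C lam : ℝ} (hC : 0 < C) (hl : 0 ≤ lam) :
    muMin C lam = Emin C lam + lam * slopeEmin C lam :=
  muMin_eq hC hl

theorem continuousOn_muMin {C : ℝ} (hC : 0 < C) : ContinuousOn (muMin C) (Ici 0) := by
  refine ContinuousOn.congr (f := fun lam => Emin C lam + lam * slopeEmin C lam) ?_
    fun lam hl => muMin_eq_slope hC hl
  refine (continuousOn_Emin hC).add fun x hx => ?_
  rcases (mem_Ici.1 hx).eq_or_lt with rfl | hx
  -- At `0` it suffices that the slope is bounded by its value there.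
  · have h : Tendsto (fun lam : ℝ => lam * slopeEmin C 0) (𝓝[Ici 0] 0)
        (𝓝 (0 * slopeEmin C 0)) :=
      ((continuous_id.mul continuous_const).tendsto 0).mono_left nhdsWithin_le_nhds
    rw [zero_mul] at h
    rw [ContinuousWithinAt, zero_mul]
    refine squeeze_zero' ?_ ?_ h
    · filter_upwards [self_mem_nhdsWithin] with lam hlam
      exact mul_nonneg hlam (slopeEmin_pos hC hlam).le
    · filter_upwards [self_mem_nhdsWithin] with lam hlam
      exact mul_le_mul_of_nonneg_left
        (antitoneOn_slopeEmin hC (mem_Ici.2 le_rfl) hlam hlam) hlam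
  · exact (continuousAt_id.mul (continuousAt_slopeEmin hC hx)).continuousWithinAt

theorem tendsto_muMin {C : ℝ} (hC : 0 < C) : Tendsto (muMin C) atTop atTop := by
  refine tendsto_atTop_mono' _ ?_ (tendsto_Emin hC)
  filter_upwards [eventually_ge_atTop 0] with lam hl
  rw [muMin_eq_slope hC hl]
  exact le_add_of_nonneg_right (mul_nonneg hl (slopeEmin_pos hC hl).le)

/-- `μ_min` is the derivative of `λ E_min(λ)`, which vanishes at `0`. -/
theorem Emin_eq_integral_muMin {C lam : ℝ} (hC : 0 < C) (hl : 0 < lam) :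
    Emin C lam = 1 / lam * ∫ ξ in (0 : ℝ)..lam, muMin C ξ := by
  have hsub : Icc 0 lam ⊆ Ici 0 := Icc_subset_Ici_self
  have h := intervalIntegral.integral_eq_sub_of_hasDerivAt_of_le hl.le
    (f := fun x => x * Emin C x) (f' := muMin C)
    (continuousOn_id.mul ((continuousOn_Emin hC).mono hsub)) (fun x hx => by
      rw [muMin_eq_slope hC hx.1.le]
      exact ((hasDerivAt_id x).mul (hasDerivAt_Emin hC hx.1)).congr_deriv (by simp))
    (((continuousOn_muMin hC).mono hsub).intervalIntegrable_of_Icc hl.le)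
  rw [h]
  field_simp
  ring

end CigarBEC

end

theorem proposition3p1 (C : ℝ) (hC : 0 < C) :
    -- the ground state and its chemical potential are well defined
    (∀ lam : ℝ, 0 ≤ lam → ∃! φ : CigarBEC.X, CigarBEC.IsGroundState C lam φ) ∧
    (∀ lam : ℝ, 0 ≤ lam →
      ∃! μ : ℝ, CigarBEC.IsChemicalPotential C lam (CigarBEC.groundState C lam) μ) ∧
    -- the minimal energy
    (∀ lam : ℝ, 0 ≤ lam → 0 < CigarBEC.Emin C lam) ∧
    StrictMonoOn (CigarBEC.Emin C) (Ici 0) ∧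
    ConcaveOn ℝ (Ici 0) (CigarBEC.Emin C) ∧
    Tendsto (CigarBEC.Emin C) atTop atTop ∧
    -- its derivative
    (ContDiffOn ℝ 1 (CigarBEC.groundState C) (Ioi 0) →
      ContDiffOn ℝ 1 (CigarBEC.Emin C) (Ioi 0) ∧
      ∀ lam : ℝ, 0 < lam →
        Integrable (fun s => (CigarBEC.groundState C lam s) ^ 4 /
          Real.sqrt (1 + 2 * lam * (CigarBEC.groundState C lam s) ^ 2)) ∧
        HasDerivAt (CigarBEC.Emin C)
          (C * ∫ s, (CigarBEC.groundState C lam s) ^ 4 /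
            Real.sqrt (1 + 2 * lam * (CigarBEC.groundState C lam s) ^ 2)) lam) ∧
    -- the chemical potential
    ContinuousOn (CigarBEC.muMin C) (Ici 0) ∧
    Tendsto (CigarBEC.muMin C) atTop atTop ∧
    (∀ lam : ℝ, 0 < lam →
      CigarBEC.Emin C lam = 1 / lam * ∫ ξ in (0 : ℝ)..lam, CigarBEC.muMin C ξ) := by
  refine ⟨fun lam hl => CigarBEC.existsUnique_isGroundState hC hl,
    fun lam hl => CigarBEC.existsUnique_isChemicalPotential hC hl,
    fun lam hl => CigarBEC.Emin_pos hC hl, CigarBEC.strictMonoOn_Emin hC,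
    CigarBEC.concaveOn_Emin hC, CigarBEC.tendsto_Emin hC,
    fun _ => ⟨CigarBEC.contDiffOn_Emin hC, fun lam hl =>
      ⟨CigarBEC.integrable_quartic hl.le _, CigarBEC.hasDerivAt_Emin hC hl⟩⟩,
    CigarBEC.continuousOn_muMin hC, CigarBEC.tendsto_muMin hC,
    fun lam hl => CigarBEC.Emin_eq_integral_muMin hC hl⟩
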